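/- Let $E$ be Watkins' curve $y^2 = x^3 + 402599774387690701016910427272483\,x$ over $\mathbb{Q}$. Then $E$ is an elliptic curve with $j(E)=1728$, and $\operatorname{rank} E(\mathbb{Q}) = 14$. It is isomorphic over $\mathbb{Q}$ to its $(-1)$-quadratic twist $E^{(-1)}$; hence $\operatorname{rank} E^{(-1)}(\mathbb{Q}) = 14$ as well. Over $\mathbb{Q}(i)$, $i=\sqrt{-1}$, one has $\operatorname{rank} E(\mathbb{Q}(i)) = 28$, and the torsion subgroup of $E(\mathbb{Q}(i))$ is isomorphic to $\mathbb{Z}/2\mathbb{Z}$. In particular $B(\mathbb{Z}/2\mathbb{Z}) \ge 28$, where, for a finite abelian group $T$, $B(T)\in\mathbb{N}\cup\{\infty\}$ denotes the supremum of the ranks of $E'(K)$ over all quadratic number fields $K$ and all elliptic curves $E'$ over $K$ whose torsion subgroup $E'(K)_{\mathrm{tors}}$ is isomorphic to $T$. -/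

import Mathlib

open scoped IntermediateField

/-- The rank of an abelian group `A`, as a cardinal: the supremum of the cardinalities of the
`ℤ`-linearly independent subsets of `A` (so no finite generation is presupposed). -/
noncomputable def abRank (A : Type) [AddCommGroup A] : Cardinal :=
  Module.rank ℤ A

/-- The rank of the group `W(K)` of `K`-rational points of a Weierstrass curve `W` over `K`. -/
noncomputable def curveRank {K : Type} [Field K] [DecidableEq K] (W : WeierstrassCurve K) :
    Cardinal :=
  abRank W.toAffine.Point

/-- The torsion subgroup of `W(K)` is isomorphic to `T`. -/
def HasTorsion {K : Type} [Field K] [DecidableEq K] (W : WeierstrassCurve K)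
    (T : Type) [AddCommGroup T] : Prop :=
  Nonempty (AddCommGroup.torsion W.toAffine.Point ≃+ T)

/-- The `d`-quadratic twist of a Weierstrass curve over a field of characteristic other than `2`.
Completing the square turns `W` into `y² = x³ + (b₂/4) x² + (b₄/2) x + b₆/4`; the twist is
`d y² = x³ + (b₂/4) x² + (b₄/2) x + b₆/4`, made monic by `(x, y) ↦ (x/d, y/d²)`. -/
def quadraticTwist {K : Type} [Field K] (W : WeierstrassCurve K) (d : K) : WeierstrassCurve K where
  a₁ := 0
  a₂ := d * (W.b₂ / 4)
  a₃ := 0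
  a₄ := d ^ 2 * (W.b₄ / 2)
  a₆ := d ^ 3 * (W.b₆ / 4)

/-- Two Weierstrass curves over `K` are isomorphic over `K`: they differ by an admissible change
of variables with coefficients in `K`. -/
def IsIsomorphic {K : Type} [Field K] (W W' : WeierstrassCurve K) : Prop :=
  ∃ C : WeierstrassCurve.VariableChange K, C • W = W'

open Classical in
/-- `B(T)`: the supremum, in `ℕ ∪ {∞}`, of the ranks of all elliptic curves `W` over all quadratic
number fields `K` such that the torsion subgroup of `W(K)` is isomorphic to `T`. -/
noncomputable def rankBound (T : Type) [AddCommGroup T] : ℕ∞ :=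
  sSup {r : ℕ∞ | ∃ (K : Type) (_ : Field K) (_ : NumberField K) (W : WeierstrassCurve K),
    Module.finrank ℚ K = 2 ∧ W.IsElliptic ∧ HasTorsion W T ∧ r = (curveRank W).toENat}

/-- Watkins' curve `y² = x³ + 402599774387690701016910427272483 x` over `ℚ`. -/
def watkinsCurve : WeierstrassCurve ℚ where
  a₁ := 0
  a₂ := 0
  a₃ := 0
  a₄ := 402599774387690701016910427272483
  a₆ := 0

instance watkinsCurve_isElliptic : watkinsCurve.IsElliptic where
  isUnit := by
    rw [isUnit_iff_ne_zero]
    norm_num [watkinsCurve, WeierstrassCurve.Δ, WeierstrassCurve.b₂, WeierstrassCurve.b₄,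
      WeierstrassCurve.b₆, WeierstrassCurve.b₈]

/-! The rank over ℚ comes from descent by 2-isogeny. Besides E : y² = x³ + a x consider E' : y² = x³
− 4a x, the isogeny φ : E → E' (`isog`) and its dual ψ (`dualIsog`), with ψφ = 2. Sending a point to
the class of its x-coordinate modulo squares, and (0, 0) to the class of the coefficient, embeds
E(ℚ)/ψE'(ℚ) and E'(ℚ)/φE(ℚ) in ℚˣ/ℚˣ². If the images have orders 2ⁿ and 2ᵐ, the rank is n + m − 2
(`finrank_eq_of_descent`); here n = m = 8.

The images are that large because each curve has eight explicit points with independent classes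
(`freeCoord_surjective`). They are no larger for local reasons. The classes are unramified outside
19 bad primes, hence given by a sign and 19 valuations modulo 2. Each of the 17 primes that divide a
exactly once imposes a linear equation in these 20 coordinates, with quadratic residue symbols as
coefficients (`residueClass_mul_add_sum`). On E these equations leave eight coordinates free. On E'
they leave nine, but one of them is the valuation at 3, which vanishes
(`descentHom_valHom_three_eq_zero`).

The count needs finite generation, which follows from heights once E(ℚ)/2E(ℚ) is finite
(`fg_of_finiteIndex`), and the rational torsion, which is found from the 2-adic behaviour of
doubling (`eq_zero_or_of_isOfFinAddOrder`).

Over ℚ(i) the automorphism [i] anticommutes with conjugation, so (P, Q) ↦ P + [i]Q from E(ℚ)² to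
E(ℚ(i)) has kernel and cokernel killed by 2. Thus the rank doubles (`rank_eq_rank_add_rank`), and
the same splitting of 2g bounds the torsion (`eq_zero_or_eq_of_isOfFinAddOrder`). -/

namespace WeierstrassCurve

/-- A Weierstrass equation of the form `y² = x³ + a₄ x`. -/
class IsX3AddX {R : Type*} [CommRing R] (W : WeierstrassCurve R) : Prop where
  a₁_eq : W.a₁ = 0
  a₂_eq : W.a₂ = 0
  a₃_eq : W.a₃ = 0
  a₆_eq : W.a₆ = 0

instance {R S : Type*} [CommRing R] [CommRing S] (W : WeierstrassCurve R) [h : W.IsX3AddX]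
    (f : R →+* S) : (W.map f).IsX3AddX where
  a₁_eq := by simp [h.a₁_eq]
  a₂_eq := by simp [h.a₂_eq]
  a₃_eq := by simp [h.a₃_eq]
  a₆_eq := by simp [h.a₆_eq]

instance {R S : Type*} [CommRing R] [CommRing S] [Algebra R S] (W : WeierstrassCurve R)
    [W.IsX3AddX] : (W.baseChange S).IsX3AddX :=
  inferInstanceAs (W.map (algebraMap R S)).IsX3AddX

instance {R S : Type*} [CommRing R] [CommRing S] [Algebra R S] (W : WeierstrassCurve R)
    [W.IsElliptic] : (W.baseChange S).IsElliptic :=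
  inferInstanceAs (W.map (algebraMap R S)).IsElliptic

/-! ### Addition formulas on y² = x³ + a x. -/

namespace IsX3AddX

attribute [simp] a₁_eq a₂_eq a₃_eq a₆_eq

variable {F : Type*} [Field F] (W W' W'' : WeierstrassCurve F)
  [W.IsX3AddX] [W'.IsX3AddX] [W''.IsX3AddX]

lemma equation_iff {x y : F} : W.toAffine.Equation x y ↔ y ^ 2 = x ^ 3 + W.a₄ * x := by
  simp [Affine.equation_iff]

lemma negY (x y : F) : W.toAffine.negY x y = -y := by
  simp [Affine.negY]

lemma addX (x₁ x₂ l : F) : W.toAffine.addX x₁ x₂ l = l ^ 2 - x₁ - x₂ := by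
  simp [Affine.addX]

lemma addY (x₁ x₂ y₁ l : F) : W.toAffine.addY x₁ x₂ y₁ l = -(l * (l ^ 2 - x₁ - x₂ - x₁) + y₁) := by
  rw [Affine.addY, Affine.negAddY, negY, addX]

lemma Δ_eq : W.Δ = -64 * W.a₄ ^ 3 := by
  simp only [Δ, b₂, b₄, b₆, b₈, a₁_eq, a₂_eq, a₃_eq, a₆_eq]; ring

variable {W} in
lemma a₄_ne_zero [W.IsElliptic] : W.a₄ ≠ 0 := by
  intro h
  have := (WeierstrassCurve.isUnit_Δ W).ne_zero
  rw [Δ_eq, h] at this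
  simp at this

variable {W} in
lemma two_ne_zero [W.IsElliptic] : (2 : F) ≠ 0 := by
  intro h
  have := (WeierstrassCurve.isUnit_Δ W).ne_zero
  rw [Δ_eq, show (64 : F) = 2 * 32 by norm_num, h] at this
  simp at this

variable [W.IsElliptic] [W'.IsElliptic] [W''.IsElliptic]

lemma nonsingular_iff {x y : F} : W.toAffine.Nonsingular x y ↔ y ^ 2 = x ^ 3 + W.a₄ * x := by
  rw [← Affine.equation_iff_nonsingular, equation_iff]

variable {W} [DecidableEq F]

omit [W.IsX3AddX] [W.IsElliptic] in
lemma slope_of_ne {x₁ x₂ : F} (y₁ y₂ : F) (h : x₁ ≠ x₂) :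
    W.toAffine.slope x₁ x₂ y₁ y₂ = (y₁ - y₂) / (x₁ - x₂) := Affine.slope_of_X_ne h

lemma slope_self {x y : F} (h : y ≠ 0) :
    W.toAffine.slope x x y y = (3 * x ^ 2 + W.a₄) / (2 * y) := by
  have h2 := two_ne_zero (W := W)
  rw [Affine.slope_of_Y_ne rfl, negY]
  · simp [two_mul]
  · rw [negY]
    intro h'
    apply h
    have : 2 * y = 0 := by linear_combination h'
    simpa [h2] using this

/-! ### Scalings, the 2-isogeny and its dual. -/

variable {W'}

/-- The isomorphism `(x, y) ↦ (u² x, u³ y)`. -/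
def scaleFun (u : F) (h : W'.a₄ = u ^ 4 * W.a₄) :
    W.toAffine.Point → W'.toAffine.Point
  | 0 => 0
  | .some x y hP => .some (u ^ 2 * x) (u ^ 3 * y) ((nonsingular_iff W').2 (by
      rw [h]; linear_combination u ^ 6 * (nonsingular_iff W).1 hP))

/-- The isomorphism `(x, y) ↦ (u² x, u³ y)` as a group homomorphism. -/
def scale (u : F) (hu : u ≠ 0) (h : W'.a₄ = u ^ 4 * W.a₄) :
    W.toAffine.Point →+ W'.toAffine.Point where
  toFun := scaleFun u h
  map_zero' := rfl
  map_add' := by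
    rintro (_ | ⟨x₁, y₁, h₁⟩) (_ | ⟨x₂, y₂, h₂⟩)
    any_goals rfl
    have inj (n : ℕ) {s t : F} : u ^ n * s = u ^ n * t ↔ s = t :=
      mul_right_inj' (pow_ne_zero n hu)
    by_cases hxy : x₁ = x₂ ∧ y₁ = W.toAffine.negY x₂ y₂
    · rw [Affine.Point.add_of_Y_eq hxy.1 hxy.2]
      simp only [scaleFun]
      rw [Affine.Point.add_of_Y_eq (by rw [hxy.1]) (by rw [hxy.2, negY, negY]; ring)]
    · have hxy' : ¬(u ^ 2 * x₁ = u ^ 2 * x₂ ∧ u ^ 3 * y₁ = W'.toAffine.negY (u ^ 2 * x₂)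
          (u ^ 3 * y₂)) := by
        rw [negY, ← mul_neg, inj, inj]
        rwa [negY] at hxy
      have hs : W'.toAffine.slope (u ^ 2 * x₁) (u ^ 2 * x₂) (u ^ 3 * y₁) (u ^ 3 * y₂) =
          u * W.toAffine.slope x₁ x₂ y₁ y₂ := by
        by_cases hx : x₁ = x₂
        · subst hx
          have hy : y₁ = y₂ := by
            have := Affine.Y_eq_of_X_eq h₁.1 h₂.1 rfl
            tauto
          subst hy
          have hy0 : y₁ ≠ 0 := by
            rintro rfl
            exact hxy ⟨rfl, by rw [negY, neg_zero]⟩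
          have h2 := two_ne_zero (W := W)
          rw [slope_self hy0, slope_self (mul_ne_zero (pow_ne_zero 3 hu) hy0), h]
          field_simp
        · rw [slope_of_ne _ _ hx, slope_of_ne _ _ (by rwa [Ne, inj])]
          have := sub_ne_zero.2 hx
          rw [← mul_sub, ← mul_sub]
          field_simp
      rw [Affine.Point.add_some hxy]
      simp only [scaleFun]
      rw [Affine.Point.add_some hxy']
      simp only [addX, addY, hs, Affine.Point.some.injEq]
      constructor <;> ring

lemma scale_zero (u : F) (hu : u ≠ 0) (h : W'.a₄ = u ^ 4 * W.a₄) :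
    scale u hu h 0 = 0 := rfl

lemma scale_some (u : F) (hu : u ≠ 0) (h : W'.a₄ = u ^ 4 * W.a₄) {x y : F}
    (hP : W.toAffine.Nonsingular x y) :
    scale u hu h (.some x y hP) = .some (u ^ 2 * x) (u ^ 3 * y) ((nonsingular_iff W').2 (by
      rw [h]; linear_combination u ^ 6 * (nonsingular_iff W).1 hP)) :=
  rfl

omit [DecidableEq F] in
lemma isog_nonsingular (h : W'.a₄ = -4 * W.a₄) {x y : F} (hP : W.toAffine.Nonsingular x y)
    (hx : x ≠ 0) :
    W'.toAffine.Nonsingular (y ^ 2 / x ^ 2) (y * (x ^ 2 - W.a₄) / x ^ 2) := by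
  rw [nonsingular_iff] at hP ⊢
  rw [h]
  field_simp
  rw [show y ^ 4 = (y ^ 2) ^ 2 by ring, hP]
  ring

/-- The isogeny `(x, y) ↦ (y² / x², y (x² - a) / x²)` from `y² = x³ + a x` to `y² = x³ - 4 a x`
with kernel `{0, (0, 0)}`, as a map. -/
def isogFun (h : W'.a₄ = -4 * W.a₄) : W.toAffine.Point → W'.toAffine.Point
  | 0 => 0
  | .some x _ hP => if hx : x = 0 then 0 else .some _ _ (isog_nonsingular h hP hx)

/-- Given a square root i of −1, the isogeny is the endomorphism 1 + [i] followed by the scaling by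
1 − i, because (1 − i)⁴ = −4. This form is visibly additive. -/
lemma isogFun_eq_scale {i : F} (hi : i ^ 2 = -1) (h : W'.a₄ = -4 * W.a₄)
    (hi0 : i ≠ 0) (hi1 : 1 - i ≠ 0) (h₁ : W.a₄ = i ^ 4 * W.a₄) (h₂ : W'.a₄ = (1 - i) ^ 4 * W.a₄)
    (P : W.toAffine.Point) :
    isogFun h P = scale (1 - i) hi1 h₂ (P + scale i hi0 h₁ P) := by
  have h2 := two_ne_zero (W := W)
  rcases P with _ | ⟨x, y, hP⟩
  · rfl
  · have hP' := (nonsingular_iff W).1 hP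
    rw [scale_some, isogFun]
    split_ifs with hx
    · have hy : y = 0 := by
        subst hx
        simpa using hP'
      rw [Affine.Point.add_of_Y_eq, scale_zero]
      · rw [hx, mul_zero]
      · rw [hy, negY]; ring
    · have hxx : x ≠ i ^ 2 * x := by
        rw [hi]
        intro h'
        have : 2 * x = 0 := by linear_combination h'
        exact hx ((mul_eq_zero.1 this).resolve_left h2)
      have hs : W.toAffine.slope x (i ^ 2 * x) y (i ^ 3 * y) = (1 + i) * y / (2 * x) := by
        rw [slope_of_ne _ _ hxx, show x - i ^ 2 * x = 2 * x by rw [hi]; ring,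
          show i ^ 3 = i ^ 2 * i by ring, hi]
        ring
      rw [Affine.Point.add_of_X_ne hxx, scale_some]
      simp only [addX, addY, hs, Affine.Point.some.injEq]
      have e₂ : (1 - i) ^ 2 = -2 * i := by linear_combination hi
      have e₃ : (1 - i) ^ 3 = -2 * (1 + i) := by linear_combination (3 - i) * hi
      rw [e₂, e₃, hi, show ((1 + i) * y / (2 * x)) ^ 2 = i * y ^ 2 / (2 * x ^ 2) by
        field_simp; linear_combination y ^ 2 * hi]
      constructor
      · field_simp
        linear_combination y ^ 2 * hi
      · field_simp
        linear_combination 2 * y * hP' + (2 * y * x ^ 3 - 2 * y ^ 3 - y ^ 3 * i) * hi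

/-- The inclusion `W(F) → W(L)` for a field extension `L` of `F`. -/
noncomputable def toExt (W : WeierstrassCurve F) (L : Type*) [Field L] [DecidableEq L]
    [Algebra F L] : W.toAffine.Point →+ (W.baseChange L).toAffine.Point :=
  Affine.Point.map (W' := W) (Algebra.ofId F L)

omit [W.IsX3AddX] [W.IsElliptic] in
lemma toExt_injective (L : Type*) [Field L] [DecidableEq L] [Algebra F L] :
    Function.Injective (toExt W L) :=
  Affine.Point.map_injective (W' := W) (Algebra.ofId F L)

omit [W.IsX3AddX] [W.IsElliptic] in
lemma toExt_some (L : Type*) [Field L] [DecidableEq L] [Algebra F L] {x y : F}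
    (hP : W.toAffine.Nonsingular x y) : ∃ h, toExt W L (.some x y hP) =
      .some (W' := (W.baseChange L).toAffine) (algebraMap F L x) (algebraMap F L y) h :=
  ⟨_, rfl⟩

lemma toExt_isogFun (L : Type*) [Field L] [DecidableEq L] [Algebra F L]
    (h : W'.a₄ = -4 * W.a₄) (h' : (W'.baseChange L).a₄ = -4 * (W.baseChange L).a₄)
    (P : W.toAffine.Point) : toExt W' L (isogFun h P) = isogFun h' (toExt W L P) := by
  rcases P with _ | ⟨x, y, hP⟩
  · rfl
  · obtain ⟨_, e⟩ := toExt_some L hP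
    rw [e, isogFun, isogFun]
    by_cases hx : x = 0
    · rw [dif_pos hx, dif_pos (by rw [hx, map_zero]), map_zero]
    · rw [dif_neg hx, dif_neg (by simpa using hx)]
      obtain ⟨_, e'⟩ := toExt_some L (isog_nonsingular h hP hx)
      rw [e']
      simp

/-- The isogeny `(x, y) ↦ (y² / x², y (x² - a) / x²)` from `y² = x³ + a x` to `y² = x³ - 4 a x`
with kernel `{0, (0, 0)}`. -/
def isog (h : W'.a₄ = -4 * W.a₄) : W.toAffine.Point →+ W'.toAffine.Point where
  toFun := isogFun h
  map_zero' := rfl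
  map_add' P Q := by
    classical
    obtain ⟨i, hi⟩ := IsAlgClosed.exists_pow_nat_eq (-1 : AlgebraicClosure F) two_pos
    have h2 := two_ne_zero (W := W.baseChange (AlgebraicClosure F))
    have hi0 : i ≠ 0 := by rintro rfl; simp at hi
    have hi1 : 1 - i ≠ 0 := by
      intro h'
      apply h2
      linear_combination (1 + i) * h' + hi
    have h' : (W'.baseChange (AlgebraicClosure F)).a₄ =
        -4 * (W.baseChange (AlgebraicClosure F)).a₄ := by
      simp [h, map_ofNat]
    have h₁ : (W.baseChange (AlgebraicClosure F)).a₄ =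
        i ^ 4 * (W.baseChange (AlgebraicClosure F)).a₄ := by
      linear_combination (1 - i ^ 2) * (W.baseChange (AlgebraicClosure F)).a₄ * hi
    have h₂ : (W'.baseChange (AlgebraicClosure F)).a₄ =
        (1 - i) ^ 4 * (W.baseChange (AlgebraicClosure F)).a₄ := by
      rw [h']
      linear_combination (-i ^ 2 + 4 * i - 5) * (W.baseChange (AlgebraicClosure F)).a₄ * hi
    -- Additivity may be tested over the algebraic closure, where i exists and the map is built from
    -- homomorphisms.
    apply toExt_injective (AlgebraicClosure F)
    simp only [map_add, toExt_isogFun _ h h', isogFun_eq_scale hi h' hi0 hi1 h₁ h₂]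
    abel

lemma isog_some (h : W'.a₄ = -4 * W.a₄) {x y : F} (hP : W.toAffine.Nonsingular x y) (hx : x ≠ 0) :
    isog h (.some x y hP) = .some _ _ (isog_nonsingular h hP hx) :=
  dif_neg hx

lemma isog_some_of_eq_zero (h : W'.a₄ = -4 * W.a₄) {x y : F} (hP : W.toAffine.Nonsingular x y)
    (hx : x = 0) : isog h (.some x y hP) = 0 :=
  dif_pos hx

/-- The isogeny dual to `isog`; it is computed as the isogeny to `W'' : y² = x³ + 16 a x` followed
by the isomorphism `(x, y) ↦ (x / 4, y / 8)`. -/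
def dualIsog (h : W'.a₄ = -4 * W.a₄) (h' : W''.a₄ = -4 * W'.a₄) :
    W'.toAffine.Point →+ W.toAffine.Point :=
  (scale (2 : F)⁻¹ (inv_ne_zero (two_ne_zero (W := W))) (by
    have := two_ne_zero (W := W)
    rw [h', h]; field_simp; norm_num)).comp (isog h')

lemma dualIsog_some (h : W'.a₄ = -4 * W.a₄) (h' : W''.a₄ = -4 * W'.a₄) {x y : F}
    (hP : W'.toAffine.Nonsingular x y) (hx : x ≠ 0) :
    ∃ hQ, dualIsog W'' h h' (.some x y hP) = .some (W' := W.toAffine)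
      (y ^ 2 / (4 * x ^ 2)) (y * (x ^ 2 + 4 * W.a₄) / (8 * x ^ 2)) hQ := by
  have h2 := two_ne_zero (W := W)
  have h4 : (4 : F) = 2 ^ 2 := by norm_num
  have h8 : (8 : F) = 2 ^ 3 := by norm_num
  have e₁ : (2 : F)⁻¹ ^ 2 * (y ^ 2 / x ^ 2) = y ^ 2 / (4 * x ^ 2) := by
    rw [h4]; field_simp
  have e₂ : (2 : F)⁻¹ ^ 3 * (y * (x ^ 2 - W'.a₄) / x ^ 2) =
      y * (x ^ 2 + 4 * W.a₄) / (8 * x ^ 2) := by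
    rw [h8, h]; field_simp; ring
  rw [dualIsog, AddMonoidHom.comp_apply, isog_some _ _ hx, scale_some]
  simp only [e₁, e₂, exists_prop, and_true]
  rw [← e₁, ← e₂]
  exact (nonsingular_iff W).2 (by
    have := (nonsingular_iff W').1 hP
    rw [h] at this ⊢
    field_simp
    rw [show y ^ 4 = (y ^ 2) ^ 2 by ring, this]
    ring)

lemma dualIsog_isog (h : W'.a₄ = -4 * W.a₄) (h' : W''.a₄ = -4 * W'.a₄) (P : W.toAffine.Point) :
    dualIsog W'' h h' (isog h P) = 2 • P := by
  have h2 := two_ne_zero (W := W)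
  rcases P with _ | ⟨x, y, hP⟩
  · exact (map_zero _).trans (smul_zero 2).symm
  have hP' := (nonsingular_iff W).1 hP
  rw [two_smul]
  by_cases hy : y = 0
  · rw [Affine.Point.add_self_of_Y_eq (by rw [hy, negY, neg_zero])]
    by_cases hx : x = 0
    · rw [isog_some_of_eq_zero h hP hx, map_zero]
    · rw [isog_some h hP hx, dualIsog, AddMonoidHom.comp_apply,
        isog_some_of_eq_zero _ _ (by rw [hy]; simp), map_zero]
  · have hx : x ≠ 0 := by
      rintro rfl
      simp_all
    have hy' : y ≠ W.toAffine.negY x y := by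
      rw [negY]
      intro h'
      have : 2 * y = 0 := by linear_combination h'
      exact hy ((mul_eq_zero.1 this).resolve_left h2)
    have h4 : (4 : F) = 2 ^ 2 := by norm_num
    have h8 : (8 : F) = 2 ^ 3 := by norm_num
    rw [isog_some h hP hx, Affine.Point.add_self_of_Y_ne hy']
    obtain ⟨_, e⟩ := dualIsog_some W'' h h' (isog_nonsingular h hP hx)
      (div_ne_zero (pow_ne_zero 2 hy) (pow_ne_zero 2 hx))
    rw [e]
    simp only [addX, addY, slope_self hy, Affine.Point.some.injEq]
    rw [h4, h8]
    constructor
    · field_simp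
      linear_combination (8 * x) * hP'
    · field_simp
      rw [show y ^ 4 = (y ^ 2) ^ 2 by ring, hP']
      ring

/-- A preimage (X, Y) of (w², wt) must satisfy Y = ±2wX. With the plus sign the curve equation
becomes X² − 4w²X − 4a = 0, which splits because t² = w⁴ + a; the root used is X = 2(t + w²). -/
lemma mem_range_dualIsog (h : W'.a₄ = -4 * W.a₄) (h' : W''.a₄ = -4 * W'.a₄) {x y w : F}
    (hP : W.toAffine.Nonsingular x y) (hx : x ≠ 0) (hw : x = w ^ 2) :
    .some x y hP ∈ (dualIsog W'' h h').range := by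
  have h2 := two_ne_zero (W := W)
  have ha := a₄_ne_zero (W := W)
  have h4 : (4 : F) = 2 ^ 2 := by norm_num
  have h8 : (8 : F) = 2 ^ 3 := by norm_num
  have hP' := (nonsingular_iff W).1 hP
  have hw0 : w ≠ 0 := by rintro rfl; simp_all
  obtain ⟨t, rfl⟩ : ∃ t, y = w * t := ⟨y / w, by field_simp⟩
  have hat : W.a₄ = (t - w ^ 2) * (t + w ^ 2) := by
    have : w ^ 2 * W.a₄ = w ^ 2 * ((t - w ^ 2) * (t + w ^ 2)) := by
      rw [hw] at hP'
      linear_combination -hP'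
    exact mul_left_cancel₀ (pow_ne_zero 2 hw0) this
  have hX : t + w ^ 2 ≠ 0 := by
    intro h0
    rw [h0, mul_zero] at hat
    exact ha hat
  have hR : W'.toAffine.Nonsingular (2 * (t + w ^ 2)) (4 * w * (t + w ^ 2)) := by
    rw [nonsingular_iff, h, hat]
    ring
  refine ⟨.some _ _ hR, ?_⟩
  obtain ⟨_, e⟩ := dualIsog_some W'' h h' hR (mul_ne_zero h2 hX)
  rw [e]
  simp only [Affine.Point.some.injEq]
  rw [hat, hw, h4, h8]
  constructor
  · field_simp
  · field_simp
    ring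

/-! ### The descent map modulo squares. -/

/-- A representative of the image of a point under the descent map to `Fˣ / Fˣ²`. -/
def descentRep : W.toAffine.Point → F
  | 0 => 1
  | .some x _ _ => if x = 0 then W.a₄ else x

omit [W.IsX3AddX] [W.IsElliptic] in
lemma descentRep_zero : descentRep (0 : W.toAffine.Point) = 1 := rfl

omit [W.IsX3AddX] [W.IsElliptic] in
lemma descentRep_some {x y : F} (hP : W.toAffine.Nonsingular x y) (hx : x ≠ 0) :
    descentRep (.some x y hP) = x :=
  if_neg hx

omit [W.IsX3AddX] [W.IsElliptic] in
lemma descentRep_some_of_eq_zero {x y : F} (hP : W.toAffine.Nonsingular x y) (hx : x = 0) :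
    descentRep (.some x y hP) = W.a₄ :=
  if_pos hx

omit [W.IsX3AddX] in
lemma descentRep_ne_zero (P : W.toAffine.Point) [W.IsX3AddX] : descentRep P ≠ 0 := by
  rcases P with _ | ⟨x, y, hP⟩
  · exact one_ne_zero
  · by_cases hx : x = 0
    · rw [descentRep_some_of_eq_zero hP hx]
      exact a₄_ne_zero
    · rwa [descentRep_some hP hx]

/-- If the line y = lx + m meets the curve in P, Q and −(P + Q), Vieta's formula gives x₁x₂x₃ = m²,
a square. -/
lemma exists_descentRep_add (P Q : W.toAffine.Point) :
    ∃ u, descentRep (P + Q) * (descentRep P * descentRep Q) = u ^ 2 := by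
  rcases P with _ | ⟨x₁, y₁, h₁⟩
  · exact ⟨descentRep Q, by rw [← Affine.Point.zero_def, zero_add, descentRep_zero]; ring⟩
  rcases Q with _ | ⟨x₂, y₂, h₂⟩
  · exact ⟨descentRep (.some x₁ y₁ h₁), by
      rw [← Affine.Point.zero_def, add_zero, descentRep_zero]; ring⟩
  by_cases hxy : x₁ = x₂ ∧ y₁ = W.toAffine.negY x₂ y₂
  · refine ⟨descentRep (.some x₁ y₁ h₁), ?_⟩
    rw [Affine.Point.add_of_Y_eq hxy.1 hxy.2, descentRep_zero]
    obtain ⟨rfl, -⟩ := hxy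
    simp only [descentRep]
    ring
  rw [Affine.Point.add_some hxy]
  have e₁ := (nonsingular_iff W).1 h₁
  have e₂ := (nonsingular_iff W).1 h₂
  -- These two relations hold for chords and tangents alike, so the slope formulas are not needed
  -- afterwards.
  obtain ⟨K₁, K₂⟩ : y₁ - y₂ = W.toAffine.slope x₁ x₂ y₁ y₂ * (x₁ - x₂) ∧
      W.toAffine.slope x₁ x₂ y₁ y₂ * (y₁ + y₂) = x₁ ^ 2 + x₁ * x₂ + x₂ ^ 2 + W.a₄ := by
    by_cases hx : x₁ = x₂
    · subst hx
      obtain rfl : y₁ = y₂ := by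
        have := Affine.Y_eq_of_X_eq h₁.1 h₂.1 rfl
        tauto
      have hy : y₁ ≠ 0 := by
        rintro rfl
        exact hxy ⟨rfl, by rw [negY, neg_zero]⟩
      have h2 := two_ne_zero (W := W)
      rw [slope_self hy]
      constructor
      · ring
      · field_simp; ring
    · have := sub_ne_zero.2 hx
      rw [slope_of_ne _ _ hx]
      constructor
      · field_simp
      · field_simp
        linear_combination e₁ - e₂
  have hX := addX W x₁ x₂ (W.toAffine.slope x₁ x₂ y₁ y₂)
  generalize_proofs h₃
  generalize W.toAffine.addY x₁ x₂ y₁ (W.toAffine.slope x₁ x₂ y₁ y₂) = y₃ at h₃ ⊢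
  generalize W.toAffine.addX x₁ x₂ (W.toAffine.slope x₁ x₂ y₁ y₂) = x₃ at hX h₃ ⊢
  generalize W.toAffine.slope x₁ x₂ y₁ y₂ = l at *
  -- `B` and `A` are the second and third Vieta formulas for (lx + m)² = x³ + ax, where m = y₁ − l
  -- x₁.
  have B : x₁ * x₂ + x₁ * x₃ + x₂ * x₃ = W.a₄ - 2 * l * (y₁ - l * x₁) := by
    linear_combination K₂ + (x₁ + x₂) * hX + l * K₁
  have A : x₁ * x₂ * x₃ = (y₁ - l * x₁) ^ 2 := by
    linear_combination x₁ * B - e₁ - x₁ ^ 2 * hX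
  -- If one root is 0 then m = 0 and the other two roots have product a. This is why (0, 0) is sent
  -- to a.
  by_cases hx₁ : x₁ = 0
  · have hy₁ : y₁ = 0 := by simpa [hx₁] using e₁
    have B' : x₂ * x₃ = W.a₄ := by simpa [hx₁, hy₁] using B
    have ha := a₄_ne_zero (W := W)
    rw [← B', mul_ne_zero_iff] at ha
    rw [descentRep_some_of_eq_zero h₁ hx₁, descentRep_some h₂ ha.1, descentRep_some h₃ ha.2]
    exact ⟨W.a₄, by linear_combination W.a₄ * B'⟩
  by_cases hx₂ : x₂ = 0
  · have hy₂ : y₂ = 0 := by simpa [hx₂] using e₂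
    have hm : y₁ - l * x₁ = 0 := by linear_combination K₁ - l * hx₂ + hy₂
    have B' : x₁ * x₃ = W.a₄ := by simpa [hx₂, hm] using B
    have ha := a₄_ne_zero (W := W)
    rw [← B', mul_ne_zero_iff] at ha
    rw [descentRep_some_of_eq_zero h₂ hx₂, descentRep_some h₁ ha.1, descentRep_some h₃ ha.2]
    exact ⟨W.a₄, by linear_combination W.a₄ * B'⟩
  rw [descentRep_some h₁ hx₁, descentRep_some h₂ hx₂]
  by_cases hx₃ : x₃ = 0
  · have hm : y₁ - l * x₁ = 0 := by
      rw [hx₃, mul_zero] at A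
      exact pow_eq_zero_iff (two_ne_zero' ℕ) |>.1 A.symm
    have B' : x₁ * x₂ = W.a₄ := by simpa [hx₃, hm] using B
    rw [descentRep_some_of_eq_zero h₃ hx₃]
    exact ⟨W.a₄, by linear_combination W.a₄ * B'⟩
  · rw [descentRep_some h₃ hx₃]
    exact ⟨y₁ - l * x₁, by linear_combination A⟩

/-- The homomorphism induced on points by a homomorphism on `Fˣ` that is trivial on squares. -/
def descentHom {M : Type*} [AddCommGroup M] (χ : Additive Fˣ →+ M) (hM : ∀ m : M, 2 • m = 0) :
    W.toAffine.Point →+ M where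
  toFun P := χ (.ofMul (Units.mk0 _ (descentRep_ne_zero P)))
  map_zero' := by
    rw [← map_zero χ]
    exact congrArg χ (congrArg Additive.ofMul (Units.ext (descentRep_zero (W := W))))
  map_add' P Q := by
    have key (m n : M) (h : m + n = 0) : m = n := by
      rw [← sub_eq_zero, sub_eq_add_neg, neg_eq_of_add_eq_zero_left
        (show n + n = 0 by rw [← two_smul ℕ, hM]), h]
    apply key
    obtain ⟨u, hu⟩ := exists_descentRep_add P Q
    have hu0 : u ≠ 0 := by
      rintro rfl
      have := mul_ne_zero (descentRep_ne_zero (P + Q))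
        (mul_ne_zero (descentRep_ne_zero P) (descentRep_ne_zero Q))
      simp_all
    rw [← map_add, ← map_add, ← hM (χ (.ofMul (Units.mk0 u hu0))), ← map_nsmul]
    congr 1
    exact congrArg Additive.ofMul (Units.ext hu)

/-- The x-coordinate of an image is (y/2x)². The exception is y = 0 with x ≠ 0: the image is then
(0, 0), and x² = 4a makes its representative a a square. -/
lemma descentRep_dualIsog (h : W'.a₄ = -4 * W.a₄) (h' : W''.a₄ = -4 * W'.a₄)
    (P : W'.toAffine.Point) : ∃ u, descentRep (dualIsog W'' h h' P) = u ^ 2 := by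
  have h2 := two_ne_zero (W := W)
  have h4 : (4 : F) = 2 ^ 2 := by norm_num
  rcases P with _ | ⟨x, y, hP⟩
  · exact ⟨1, by rw [one_pow]; exact congrArg descentRep (map_zero _)⟩
  by_cases hx : x = 0
  · refine ⟨1, ?_⟩
    rw [dualIsog, AddMonoidHom.comp_apply, isog_some_of_eq_zero _ _ hx, map_zero, one_pow]
    exact descentRep_zero
  obtain ⟨_, e⟩ := dualIsog_some W'' h h' hP hx
  rw [e]
  by_cases hy : y = 0
  · refine ⟨x / 2, ?_⟩
    rw [descentRep_some_of_eq_zero _ (by rw [hy]; simp)]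
    have := (nonsingular_iff W').1 hP
    rw [hy, h] at this
    have h0 : x * (x ^ 2 - 4 * W.a₄) = 0 := by linear_combination -this
    have h1 := (mul_eq_zero.1 h0).resolve_left hx
    field_simp
    linear_combination -h1
  · refine ⟨y / (2 * x), ?_⟩
    rw [descentRep_some]
    · rw [h4]; field_simp
    · rw [h4]
      positivity

end IsX3AddX

end WeierstrassCurve

/-! ### Heights and the Mordell–Weil theorem. -/

namespace WeierstrassCurve.IsX3AddX

section AddSub

variable {F : Type*} [Field F] [DecidableEq F] {W : WeierstrassCurve F} [W.IsX3AddX]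

omit [DecidableEq F] in
lemma eval_addSubMap (v : Fin 3 → F) :
    (fun i ↦ (addSubMap W i).eval v) = ![(v 0 - W.a₄ * v 2) ^ 2,
      2 * v 1 * (v 0 + W.a₄ * v 2), v 1 ^ 2 - 4 * v 0 * v 2] := by
  ext i
  fin_cases i <;> simp [addSubMap, b₂, b₄, b₆, b₈] <;> ring

variable [W.IsElliptic]

lemma exists_eval_addSubMap_self (P : W.toAffine.Point) :
    ∃ c : F, c ≠ 0 ∧ (fun i ↦ (addSubMap W i).eval (P.sym2x P)) = c • (P + P).sym2x 0 := by
  have h2 := two_ne_zero (W := W)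
  have ha := a₄_ne_zero (W := W)
  rw [eval_addSubMap]
  rcases P with _ | ⟨x, y, h⟩
  · refine ⟨1, one_ne_zero, ?_⟩
    rw [← Affine.Point.zero_def, add_zero, Affine.Point.sym2x_zero_zero]
    ext i; fin_cases i <;> simp
  have e := (nonsingular_iff W).1 h
  rw [Affine.Point.sym2x_some_some]
  by_cases hy : y = 0
  · rw [Affine.Point.add_self_of_Y_eq (by rw [hy, negY, neg_zero]),
      Affine.Point.sym2x_zero_zero]
    have h0 : x * (x ^ 2 + W.a₄) = 0 := by rw [hy] at e; linear_combination -e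
    refine ⟨(x * x - W.a₄) ^ 2, pow_ne_zero 2 fun h1 ↦ ?_, ?_⟩
    · rcases mul_eq_zero.1 h0 with h0 | h0
      · exact ha (by rw [h0] at h1; linear_combination -h1)
      · exact mul_ne_zero h2 ha (by linear_combination h0 - h1)
    · ext i; fin_cases i
      · simp
      · suffices 2 * (x + x) * (x * x + W.a₄) = 0 by simpa using this
        linear_combination 4 * h0
      · simp; ring
  · have hy' : y ≠ W.toAffine.negY x y := by
      rw [negY]
      intro h'
      exact mul_ne_zero h2 hy (by linear_combination h')
    rw [Affine.Point.add_self_of_Y_ne hy', Affine.Point.sym2x_some_zero, addX, slope_self hy]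
    refine ⟨(2 * y) ^ 2, pow_ne_zero 2 (mul_ne_zero h2 hy), ?_⟩
    ext i; fin_cases i
    · simp; field_simp; linear_combination 8 * x * e
    · simp; linear_combination -4 * e
    · simp; ring

/-- The product and sum of x(P + Q) and x(P − Q) are, projectively, quadratic forms in those of x(P)
and x(Q). This is the source of the approximate parallelogram law for heights. -/
lemma exists_eval_addSubMap (P Q : W.toAffine.Point) :
    ∃ c : F, c ≠ 0 ∧ (fun i ↦ (addSubMap W i).eval (P.sym2x Q)) = c • (P + Q).sym2x (P - Q) := by
  by_cases hPQ : P = Q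
  · subst hPQ
    rw [sub_self]
    exact exists_eval_addSubMap_self P
  by_cases hPQ' : P = -Q
  · obtain rfl : Q = -P := by rw [hPQ', neg_neg]
    rw [Affine.Point.sym2x_neg_right, add_neg_cancel, sub_neg_eq_add, Affine.Point.sym2x_comm 0]
    exact exists_eval_addSubMap_self P
  rw [eval_addSubMap]
  rcases P with _ | ⟨x₁, y₁, h₁⟩
  · refine ⟨1, one_ne_zero, ?_⟩
    rw [← Affine.Point.zero_def, zero_add, zero_sub, Affine.Point.sym2x_neg_right]
    rcases Q with _ | ⟨x₂, y₂, h₂⟩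
    · exact absurd rfl hPQ
    · rw [Affine.Point.sym2x_zero_some, Affine.Point.sym2x_some_some]
      ext i; fin_cases i <;> simp <;> ring
  rcases Q with _ | ⟨x₂, y₂, h₂⟩
  · refine ⟨1, one_ne_zero, ?_⟩
    rw [← Affine.Point.zero_def, add_zero, sub_zero, Affine.Point.sym2x_some_zero,
      Affine.Point.sym2x_some_some]
    ext i; fin_cases i <;> simp <;> ring
  have hx : x₁ ≠ x₂ := by
    intro hx
    rcases Affine.Point.X_eq_iff.1 hx with h | h
    exacts [hPQ h, hPQ' h]
  have e₁ := (nonsingular_iff W).1 h₁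
  have e₂ := (nonsingular_iff W).1 h₂
  have hx' := sub_ne_zero.2 hx
  rw [sub_eq_add_neg (Affine.Point.some _ _ _), Affine.Point.neg_some, Affine.Point.add_of_X_ne hx,
    Affine.Point.add_of_X_ne hx, Affine.Point.sym2x_some_some, Affine.Point.sym2x_some_some,
    addX, addX, slope_of_ne _ _ hx, slope_of_ne _ _ hx, negY]
  refine ⟨(x₁ - x₂) ^ 2, pow_ne_zero 2 hx', ?_⟩
  ext i; fin_cases i
  · simp
    field_simp
    trans (y₁ ^ 2 - y₂ ^ 2) ^ 2 - 2 * ((x₁ + x₂) * (x₁ - x₂) ^ 2) * (y₁ ^ 2 + y₂ ^ 2) +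
      ((x₁ + x₂) * (x₁ - x₂) ^ 2) ^ 2
    · rw [e₁, e₂]; ring
    · ring
  · simp
    field_simp
    linear_combination -2 * e₁ - 2 * e₂
  · simp; ring

end AddSub

open Height

variable {F : Type*} [Field F] [DecidableEq F] [AdmissibleAbsValues F]
  {W : WeierstrassCurve F} [W.IsX3AddX] [W.IsElliptic]

lemma exists_parallelogram_bound : ∃ C, ∀ P Q : W.toAffine.Point,
    |logHeight (P + Q).xRep + logHeight (P - Q).xRep -
      2 * (logHeight P.xRep + logHeight Q.xRep)| ≤ C := by
  obtain ⟨C₁, h₁⟩ := abs_logHeight_addSubMap_sub_two_mul_logHeight_le W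
  obtain ⟨C₂, h₂⟩ := abs_logHeight_sym2_sub_le F
  have key (P Q : W.toAffine.Point) :
      |logHeight (P.sym2x Q) - (logHeight P.xRep + logHeight Q.xRep)| ≤ C₂ := by
    have e (R : W.toAffine.Point) : R.xRep = ![R.xRep 0, R.xRep 1] := by
      ext i; fin_cases i <;> rfl
    have := h₂ (a := P.xRep 0) (b := P.xRep 1) (c := Q.xRep 0) (d := Q.xRep 1)
      (by rw [← e]; exact P.xRep_ne_zero) (by rw [← e]; exact Q.xRep_ne_zero)
    rwa [← e, ← e] at this
  refine ⟨C₁ + 3 * C₂, fun P Q ↦ ?_⟩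
  obtain ⟨c, hc, h⟩ := exists_eval_addSubMap P Q
  have h₃ := h₁ (P.sym2x Q)
  rw [h, logHeight_smul_eq_logHeight _ hc] at h₃
  have h₄ := key (P + Q) (P - Q)
  have h₅ := key P Q
  rw [abs_le] at *
  constructor <;> linarith [h₃.1, h₃.2, h₄.1, h₄.2, h₅.1, h₅.2]

/-- The x-coordinate determines a point up to sign, so finitely many x of bounded height leave
finitely many points. -/
instance [Northcott (logHeight₁ (K := F))] :
    Northcott fun P : W.toAffine.Point ↦ logHeight P.xRep where
  finite_le B := by
    have hfin := Northcott.finite_le (h := logHeight₁ (K := F)) B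
    refine Set.Finite.of_finite_fibers (fun P : W.toAffine.Point ↦ P.xRep) ?_ fun v _ ↦ ?_
    · refine (((hfin.image fun x ↦ ![x, 1]).insert ![1, 0])).subset ?_
      rintro _ ⟨_ | ⟨x, y, h⟩, hP, rfl⟩
      · exact Or.inl rfl
      · refine Or.inr ⟨x, ?_, rfl⟩
        rw [Set.mem_ofPred_eq, logHeight₁_eq_logHeight]
        exact hP
    · by_cases hv : ∃ P : W.toAffine.Point, P.xRep = v
      · obtain ⟨P, rfl⟩ := hv
        refine (Set.toFinite {P, -P}).subset ?_
        rintro Q ⟨-, hQ⟩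
        exact Affine.Point.eq_or_eq_neg_of_xRep_eq_xRep hQ
      · refine Set.finite_empty.subset ?_
        rintro Q ⟨-, hQ⟩
        exact hv ⟨Q, hQ⟩

/-- A weak Mordell-Weil theorem implies the Mordell-Weil theorem. -/
theorem fg_of_finiteIndex [Northcott (logHeight₁ (K := F))]
    (h : (nsmulAddMonoidHom (α := W.toAffine.Point) 2).range.FiniteIndex) :
    AddGroup.FG W.toAffine.Point := by
  obtain ⟨C, hC⟩ := exists_parallelogram_bound (W := W)
  exact AddCommGroup.fg_of_descent' h (fun P ↦ logHeight_nonneg P.xRep) hC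

theorem fg_rat {W : WeierstrassCurve ℚ} [W.IsX3AddX] [W.IsElliptic]
    (h : (nsmulAddMonoidHom (α := W.toAffine.Point) 2).range.FiniteIndex) :
    AddGroup.FG W.toAffine.Point := fg_of_finiteIndex h

end WeierstrassCurve.IsX3AddX

/-! ### Characters of ℚˣ modulo squares. -/

section Valuation

variable {p : ℕ} [Fact p.Prime]

lemma Rat.den_cast_ne_zero_of_padicValRat_nonneg {x : ℚ} (h : 0 ≤ padicValRat p x) :
    (x.den : ZMod p) ≠ 0 := by
  rw [Ne, ZMod.natCast_eq_zero_iff]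
  intro hd
  have hn : ¬ p ∣ x.num.natAbs := fun hn ↦
    (Fact.out : p.Prime).one_lt.ne' (Nat.eq_one_of_dvd_coprimes x.reduced hn hd)
  rw [padicValRat_def, padicValInt, padicValNat.eq_zero_of_not_dvd hn] at h
  have := one_le_padicValNat_of_dvd x.den_nz hd
  omega

lemma Rat.cast_zmod_eq_zero_of_padicValRat_pos {x : ℚ} (h : 0 < padicValRat p x) :
    (x : ZMod p) = 0 := by
  rw [Rat.cast_def, (ZMod.intCast_zmod_eq_zero_iff_dvd _ _).2, zero_div]
  by_contra hn
  rw [padicValRat_def, padicValInt.eq_zero_of_not_dvd hn] at h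
  omega

lemma Rat.cast_zmod_ne_zero_of_padicValRat_eq_zero {x : ℚ} (hx : x ≠ 0)
    (h : padicValRat p x = 0) : (x : ZMod p) ≠ 0 := by
  have h₁ := Rat.den_cast_ne_zero_of_padicValRat_nonneg h.ge
  have h₂ := Rat.den_cast_ne_zero_of_padicValRat_nonneg (p := p) (x := x⁻¹)
    (by simp [padicValRat.inv, h])
  intro h0
  have := Rat.cast_mul_of_ne_zero h₁ h₂
  rw [mul_inv_cancel₀ hx, h0, zero_mul, Rat.cast_one] at this
  exact one_ne_zero this

/-- The reduction modulo `p` of the unit part of a rational number. -/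
def unitResidue (p : ℕ) [Fact p.Prime] (x : ℚ) : ZMod p :=
  ((x * (p : ℚ) ^ (-padicValRat p x) : ℚ) : ZMod p)

variable (p) in
lemma padicValRat_unitPart {x : ℚ} (hx : x ≠ 0) :
    padicValRat p (x * (p : ℚ) ^ (-padicValRat p x)) = 0 := by
  have hp : (p : ℚ) ≠ 0 := by exact_mod_cast (Fact.out : p.Prime).ne_zero
  rw [padicValRat.mul hx (zpow_ne_zero _ hp), padicValRat.zpow,
    padicValRat.self (Fact.out : p.Prime).one_lt]
  ring

lemma unitResidue_ne_zero {x : ℚ} (hx : x ≠ 0) : unitResidue p x ≠ 0 := by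
  have hp : (p : ℚ) ≠ 0 := by exact_mod_cast (Fact.out : p.Prime).ne_zero
  exact Rat.cast_zmod_ne_zero_of_padicValRat_eq_zero (mul_ne_zero hx (zpow_ne_zero _ hp))
    (padicValRat_unitPart p hx)

lemma unitResidue_mul {x y : ℚ} (hx : x ≠ 0) (hy : y ≠ 0) :
    unitResidue p (x * y) = unitResidue p x * unitResidue p y := by
  have hp : (p : ℚ) ≠ 0 := by exact_mod_cast (Fact.out : p.Prime).ne_zero
  rw [unitResidue, unitResidue, unitResidue, ← Rat.cast_mul_of_ne_zero
    (Rat.den_cast_ne_zero_of_padicValRat_nonneg (padicValRat_unitPart p hx).ge)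
    (Rat.den_cast_ne_zero_of_padicValRat_nonneg (padicValRat_unitPart p hy).ge),
    padicValRat.mul hx hy, neg_add, zpow_add₀ hp]
  congr 1
  ring

lemma unitResidue_eq_cast {x : ℚ} (h : padicValRat p x = 0) :
    unitResidue p x = (x : ZMod p) := by
  rw [unitResidue, h]
  simp

lemma padicValRat_one_add {t : ℚ} (ht : 0 < padicValRat p t) :
    1 + t ≠ 0 ∧ padicValRat p (1 + t) = 0 := by
  have h0 : 1 + t ≠ 0 := by
    intro h
    rw [show t = -1 by linarith, padicValRat.neg, padicValRat.one] at ht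
    exact lt_irrefl _ ht
  exact ⟨h0, by
    rw [padicValRat.add_eq_of_lt h0 one_ne_zero (by rintro rfl; simp at ht)
      (by rwa [padicValRat.one]), padicValRat.one]⟩

lemma unitResidue_one_add {t : ℚ} (ht : 0 < padicValRat p t) : unitResidue p (1 + t) = 1 := by
  rw [unitResidue_eq_cast (padicValRat_one_add ht).2, Rat.cast_add_of_ne_zero (by simp)
    (Rat.den_cast_ne_zero_of_padicValRat_nonneg ht.le),
    Rat.cast_zmod_eq_zero_of_padicValRat_pos ht, Rat.cast_one, add_zero]

/-- The quadratic residue class of the unit part of a rational number. -/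
noncomputable def residueHom (p : ℕ) [Fact p.Prime] : Additive ℚˣ →+ ZMod 2 where
  toFun u := if quadraticChar (ZMod p) (unitResidue p (u.toMul : ℚˣ)) = 1 then 0 else 1
  map_zero' := by
    have : unitResidue p 1 = 1 := by rw [unitResidue_eq_cast (padicValRat.one)]; simp
    simp [this]
  map_add' u v := by
    have hu := unitResidue_ne_zero (p := p) u.toMul.ne_zero
    have hv := unitResidue_ne_zero (p := p) v.toMul.ne_zero
    rw [toMul_add, Units.val_mul, unitResidue_mul u.toMul.ne_zero v.toMul.ne_zero]
    generalize unitResidue p u.toMul = a at *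
    generalize unitResidue p v.toMul = b at *
    rw [map_mul]
    rcases quadraticChar_dichotomy hu with h | h <;>
    rcases quadraticChar_dichotomy hv with h' | h' <;> rw [h, h'] <;> decide

/-- The `p`-adic valuation modulo `2`. -/
noncomputable def valHom (p : ℕ) [Fact p.Prime] : Additive ℚˣ →+ ZMod 2 where
  toFun u := (padicValRat p (u.toMul : ℚˣ) : ZMod 2)
  map_zero' := by simp
  map_add' u v := by
    rw [toMul_add, Units.val_mul, padicValRat.mul u.toMul.ne_zero v.toMul.ne_zero, Int.cast_add]

/-- The sign of a rational number. -/
def ratSignHom : Additive ℚˣ →+ ZMod 2 where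
  toFun u := if 0 < (u.toMul : ℚ) then 0 else 1
  map_zero' := by simp
  map_add' u v := by
    rw [toMul_add, Units.val_mul]
    have hu := u.toMul.ne_zero
    have hv := v.toMul.ne_zero
    generalize (u.toMul : ℚ) = a at *
    generalize (v.toMul : ℚ) = b at *
    rcases hu.lt_or_gt with h | h <;> rcases hv.lt_or_gt with h' | h'
    · rw [if_pos (mul_pos_of_neg_of_neg h h'), if_neg h.not_gt, if_neg h'.not_gt]; decide
    · rw [if_neg (mul_neg_of_neg_of_pos h h').not_gt, if_neg h.not_gt, if_pos h']; decide
    · rw [if_neg (mul_neg_of_pos_of_neg h h').not_gt, if_neg h'.not_gt, if_pos h]; decide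
    · rw [if_pos (mul_pos h h'), if_pos h', if_pos h]; decide

lemma ZMod.two_nsmul_eq_zero (a : ZMod 2) : 2 • a = 0 := by
  revert a; decide

lemma Nat.isSquare_of_even_padicValNat {n : ℕ} (hn : n ≠ 0)
    (h : ∀ p : ℕ, p.Prime → Even (padicValNat p n)) : IsSquare n := by
  obtain ⟨a, b, rfl, ha⟩ := Nat.sq_mul_squarefree n
  have ha0 : a ≠ 0 := right_ne_zero_of_mul hn
  have hb0 : b ≠ 0 := by rintro rfl; simp at hn
  suffices a = 1 by rw [this]; exact ⟨b, by ring⟩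
  by_contra ha1
  obtain ⟨p, hp, hpa⟩ := Nat.exists_prime_and_dvd ha1
  have : Fact p.Prime := ⟨hp⟩
  have h₁ := h p hp
  rw [padicValNat.mul (pow_ne_zero 2 hb0) ha0, padicValNat.pow, Nat.even_add] at h₁
  have h₂ : Even (padicValNat p a) := h₁.1 (even_two_mul _)
  have h₃ := one_le_padicValNat_of_dvd ha0 hpa
  have h₄ : 2 ≤ padicValNat p a := by obtain ⟨k, hk⟩ := h₂; omega
  have h₅ : p * p ∣ a := by
    rw [← sq]
    exact (padicValNat_dvd_iff_le ha0).2 h₄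
  exact hp.one_lt.ne' (Nat.isUnit_iff.1 (ha p h₅))

lemma Rat.isSquare_of_even_padicValRat {x : ℚ} (hx : 0 < x)
    (h : ∀ p : ℕ, p.Prime → Even (padicValRat p x)) : IsSquare x := by
  have hn : x.num.natAbs ≠ 0 := by simpa using hx.ne'
  have key (p : ℕ) (hp : p.Prime) :
      Even (padicValNat p x.num.natAbs) ∧ Even (padicValNat p x.den) := by
    have := h p hp
    rw [padicValRat_def, padicValInt] at this
    by_cases hd : p ∣ x.den
    · have hn : ¬ p ∣ x.num.natAbs := fun hn ↦
        hp.one_lt.ne' (Nat.eq_one_of_dvd_coprimes x.reduced hn hd)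
      rw [padicValNat.eq_zero_of_not_dvd hn] at this ⊢
      exact ⟨Even.zero, by simpa using this⟩
    · rw [padicValNat.eq_zero_of_not_dvd hd] at this ⊢
      exact ⟨by simpa using this, Even.zero⟩
  obtain ⟨a, ha⟩ := Nat.isSquare_of_even_padicValNat hn fun p hp ↦ (key p hp).1
  obtain ⟨b, hb⟩ := Nat.isSquare_of_even_padicValNat x.den_nz fun p hp ↦ (key p hp).2
  refine ⟨a / b, ?_⟩
  have h₁ : (x.num : ℚ) = a * a := by
    rw [← Int.natAbs_of_nonneg (Rat.num_nonneg.2 hx.le), ha]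
    push_cast
    ring
  rw [← Rat.num_div_den x, h₁, hb]
  push_cast
  field_simp

/-- A homomorphism from the rational numbers supported at the primes `q i` to `ZMod 2` is
determined by its values at `-1` and at the `q i`. -/
lemma hom_eq_sum {ι : Type*} [Fintype ι] {q : ι → ℕ} [∀ i, Fact (q i).Prime]
    (hq : Function.Injective q) (χ : Additive ℚˣ →+ ZMod 2) (u : Additive ℚˣ)
    (hu : ∀ r : ℕ, ∀ _ : Fact r.Prime, r ∉ Set.range q → valHom r u = 0) (b : ι → Additive ℚˣ)
    (hb : ∀ i, ((b i).toMul : ℚ) = q i) :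
    χ u = ratSignHom u * χ (.ofMul (-1)) + ∑ i, valHom (q i) u * χ (b i) := by
  classical
  have hval (r : ℕ) [Fact r.Prime] (i : ι) : valHom r (b i) = if r = q i then 1 else 0 := by
    change ((padicValRat r ((b i).toMul : ℚ) : ℤ) : ZMod 2) = _
    rw [hb, padicValRat.of_nat]
    split_ifs with h
    · subst h; simp
    · simp [padicValNat_primes h]
  have hsign (i : ι) : ratSignHom (b i) = 0 := by
    refine if_pos ?_
    rw [hb]
    exact_mod_cast (Fact.out : (q i).Prime).pos
  have hsign1 : ratSignHom (.ofMul (-1)) = 1 := by simp [ratSignHom]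
  have hval1 (r : ℕ) [Fact r.Prime] : valHom r (.ofMul (-1)) = 0 := by
    change ((padicValRat r (-1) : ℤ) : ZMod 2) = _
    simp [padicValRat.neg]
  have hsm (ψ : Additive ℚˣ →+ ZMod 2) (a : ZMod 2) (w : Additive ℚˣ) :
      ψ (a.val • w) = a * ψ w := by
    rw [map_nsmul, nsmul_eq_mul, ZMod.natCast_val, ZMod.cast_id]
  -- Here w is u times its expected factorisation into −1 and the q i. It is positive with even
  -- valuations, hence a square, and χ kills it.
  set w : Additive ℚˣ :=
    u + ((ratSignHom u).val • Additive.ofMul (-1) + ∑ i, (valHom (q i) u).val • b i)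
    with hw
  have hψ (ψ : Additive ℚˣ →+ ZMod 2) :
      ψ w = ψ u + (ratSignHom u * ψ (.ofMul (-1)) + ∑ i, valHom (q i) u * ψ (b i)) := by
    simp only [hw, map_add, map_sum, hsm]
  have hsq : IsSquare ((w.toMul : ℚˣ) : ℚ) := by
    apply Rat.isSquare_of_even_padicValRat
    · have h : ratSignHom w = 0 := by
        rw [hψ, hsign1]
        simp only [hsign, mul_zero, Finset.sum_const_zero, add_zero, mul_one]
        rw [← two_nsmul, ZMod.two_nsmul_eq_zero]
      by_contra h'
      exact one_ne_zero ((if_neg h').symm.trans h)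
    · intro r hr
      have : Fact r.Prime := ⟨hr⟩
      rw [← ZMod.intCast_eq_zero_iff_even]
      change valHom r w = 0
      rw [hψ, hval1]
      simp only [hval]
      by_cases hrq : r ∈ Set.range q
      · obtain ⟨i, rfl⟩ := hrq
        rw [Finset.sum_eq_single i (fun j _ hj ↦ by rw [if_neg (fun h ↦ hj (hq h.symm)), mul_zero])
          (fun h ↦ absurd (Finset.mem_univ i) h), if_pos rfl, mul_zero, zero_add, mul_one,
          ← two_nsmul, ZMod.two_nsmul_eq_zero]
      · rw [hu r _ hrq, Finset.sum_eq_zero (fun j _ ↦ by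
          rw [if_neg (fun h ↦ hrq ⟨j, h.symm⟩), mul_zero])]
        simp
  have hχ : χ w = 0 := by
    obtain ⟨t, ht⟩ := hsq
    have ht0 : t ≠ 0 := by rintro rfl; exact w.toMul.ne_zero (by rw [ht, mul_zero])
    have : w = 2 • Additive.ofMul (Units.mk0 t ht0) := by
      rw [two_nsmul]
      exact congrArg Additive.ofMul (Units.ext ht)
    rw [this, map_nsmul, ZMod.two_nsmul_eq_zero]
  rw [hψ] at hχ
  generalize ratSignHom u * χ (.ofMul (-1)) + ∑ i, valHom (q i) u * χ (b i) = s at *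
  generalize χ u = t at *
  revert s t; decide

end Valuation

/-! ### Local conditions on the image of the descent map. -/

namespace WeierstrassCurve.IsX3AddX

variable {W : WeierstrassCurve ℚ} [W.IsX3AddX] [W.IsElliptic]

/-- The coefficient `a` of `y² = x³ + a x` as an element of `ℚˣ`, written additively. -/
def a₄Unit (W : WeierstrassCurve ℚ) [W.IsX3AddX] [W.IsElliptic] : Additive ℚˣ :=
  .ofMul (Units.mk0 W.a₄ (a₄_ne_zero (W := W)))

lemma descentHom_some_of_eq_zero (χ : Additive ℚˣ →+ ZMod 2) {x y : ℚ}
    (h : W.toAffine.Nonsingular x y) (hx : x = 0) :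
    descentHom χ ZMod.two_nsmul_eq_zero (.some x y h) = χ (a₄Unit W) :=
  congrArg χ (congrArg Additive.ofMul (Units.ext (descentRep_some_of_eq_zero h hx)))

lemma descentHom_some (χ : Additive ℚˣ →+ ZMod 2) {x y : ℚ}
    (h : W.toAffine.Nonsingular x y) (hx : x ≠ 0) :
    descentHom χ ZMod.two_nsmul_eq_zero (.some x y h) = χ (.ofMul (Units.mk0 x hx)) :=
  congrArg χ (congrArg Additive.ofMul (Units.ext (descentRep_some h hx)))

omit [W.IsX3AddX] [W.IsElliptic] in
lemma hom_eq_zero_of_sq (χ : Additive ℚˣ →+ ZMod 2) {u v w : ℚˣ} (h : (u : ℚ) = v * w ^ 2) :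
    χ (.ofMul u) = χ (.ofMul v) := by
  have : Additive.ofMul u = .ofMul v + 2 • .ofMul w := congrArg Additive.ofMul (Units.ext h)
  rw [this, map_add, map_nsmul, ZMod.two_nsmul_eq_zero, add_zero]

/-- Since x(x² + a) = y², the two factors have the same class modulo squares. The factor x² + a is
often easier to analyse p-adically. -/
lemma hom_eq_hom_sq_add (χ : Additive ℚˣ →+ ZMod 2) {x y : ℚ} (h : W.toAffine.Nonsingular x y)
    (hx : x ≠ 0) (h' : x ^ 2 + W.a₄ ≠ 0) :
    χ (.ofMul (Units.mk0 x hx)) = χ (.ofMul (Units.mk0 (x ^ 2 + W.a₄) h')) := by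
  have e := (nonsingular_iff W).1 h
  have hy : y ≠ 0 := by
    rintro rfl
    exact mul_ne_zero hx h' (by linear_combination -e)
  have h1 : Units.mk0 x hx * Units.mk0 (x ^ 2 + W.a₄) h' = Units.mk0 y hy ^ 2 :=
    Units.ext (by simp only [Units.val_mul, Units.val_pow_eq_pow_val, Units.val_mk0]
                  linear_combination -e)
  have h2 : χ (.ofMul (Units.mk0 x hx)) + χ (.ofMul (Units.mk0 (x ^ 2 + W.a₄) h')) = 0 := by
    rw [← map_add, ← ofMul_mul, h1, ofMul_pow, map_nsmul, ZMod.two_nsmul_eq_zero]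
  generalize χ (.ofMul (Units.mk0 x hx)) = s at *
  generalize χ (.ofMul (Units.mk0 (x ^ 2 + W.a₄) h')) = t at *
  revert s t; decide

omit [W.IsX3AddX] [W.IsElliptic] in
lemma valHom_eq_zero_of_even {p : ℕ} [Fact p.Prime] {u : ℚˣ} (h : Even (padicValRat p u)) :
    valHom p (.ofMul u) = 0 :=
  (ZMod.intCast_eq_zero_iff_even).2 h

omit [W.IsX3AddX] [W.IsElliptic] in
lemma even_of_valHom_eq_zero {p : ℕ} [Fact p.Prime] {u : ℚˣ} (h : valHom p (.ofMul u) = 0) :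
    Even (padicValRat p u) :=
  (ZMod.intCast_eq_zero_iff_even).1 h

/-- The descent map is unramified at the primes that do not divide the discriminant. -/
lemma descentHom_valHom_eq_zero {p : ℕ} [Fact p.Prime] (ha : padicValRat p W.a₄ = 0)
    (P : W.toAffine.Point) : descentHom (valHom p) ZMod.two_nsmul_eq_zero P = 0 := by
  have ha0 := a₄_ne_zero (W := W)
  rcases P with _ | ⟨x, y, h⟩
  · exact map_zero _
  by_cases hx : x = 0
  · rw [descentHom_some_of_eq_zero _ h hx]
    exact valHom_eq_zero_of_even (by rw [Units.val_mk0, ha]; exact Even.zero)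
  rw [descentHom_some _ h hx]
  have hx2 : x ^ 2 ≠ 0 := pow_ne_zero 2 hx
  by_cases h' : x ^ 2 + W.a₄ = 0
  · have : padicValRat p (x ^ 2) = 0 := by
      rw [show x ^ 2 = -W.a₄ by linear_combination h', padicValRat.neg, ha]
    rw [padicValRat.pow] at this
    refine valHom_eq_zero_of_even ?_
    rw [Units.val_mk0, show padicValRat p x = 0 by simpa using this]
    exact Even.zero
  -- Unless v(x) = 0, one term of x² + a dominates, and both terms have even valuation.
  rcases lt_trichotomy (padicValRat p x) 0 with hv | hv | hv
  · rw [hom_eq_hom_sq_add _ h hx h']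
    refine valHom_eq_zero_of_even ?_
    have hlt : padicValRat p (x ^ 2) < padicValRat p W.a₄ := by
      rw [padicValRat.pow, ha]; push_cast; omega
    rw [Units.val_mk0, padicValRat.add_eq_of_lt h' hx2 ha0 hlt, padicValRat.pow]
    exact even_two_mul _
  · exact valHom_eq_zero_of_even (by rw [Units.val_mk0, hv]; exact Even.zero)
  · rw [hom_eq_hom_sq_add _ h hx h']
    refine valHom_eq_zero_of_even ?_
    have hlt : padicValRat p W.a₄ < padicValRat p (x ^ 2) := by
      rw [padicValRat.pow, ha]; push_cast; omega
    rw [Units.val_mk0, add_comm, padicValRat.add_eq_of_lt (by rwa [add_comm]) ha0 hx2 hlt, ha]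
    exact Even.zero

/-- At a prime that divides `a` exactly once, the local image of the descent map of `y² = x³ + a x`
is generated by the class of `a`. -/
lemma descentHom_eq_zero_of_padicValRat_eq_one {p : ℕ} [Fact p.Prime] (χ : Additive ℚˣ →+ ZMod 2)
    (hχ : ∀ u : ℚˣ, 0 < padicValRat p (u - 1) → χ (.ofMul u) = 0)
    (ha : padicValRat p W.a₄ = 1) (hχa : χ (a₄Unit W) = 0) (P : W.toAffine.Point) :
    descentHom χ ZMod.two_nsmul_eq_zero P = 0 := by
  have ha0 := a₄_ne_zero (W := W)
  rcases P with _ | ⟨x, y, h⟩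
  · exact map_zero _
  by_cases hx : x = 0
  · rwa [descentHom_some_of_eq_zero _ h hx]
  have hx2 : x ^ 2 ≠ 0 := pow_ne_zero 2 hx
  have hv2 : padicValRat p (x ^ 2) = 2 * padicValRat p x := by rw [padicValRat.pow]; norm_num
  have h' : x ^ 2 + W.a₄ ≠ 0 := by
    intro h'
    rw [show x ^ 2 = -W.a₄ by linear_combination h', padicValRat.neg, ha] at hv2
    omega
  rw [descentHom_some _ h hx, hom_eq_hom_sq_add _ h hx h']
  -- The valuations of x² and a have different parity, so they never tie: x² + a is x² or a times an
  -- element 1 + t with v(t) > 0.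
  rcases le_or_gt (padicValRat p x) 0 with hv | hv
  · have hpos : 0 < padicValRat p (W.a₄ / x ^ 2) := by
      rw [padicValRat.div ha0 hx2, ha, hv2]; omega
    have h1 := (padicValRat_one_add hpos).1
    rw [hom_eq_zero_of_sq χ (v := Units.mk0 _ h1) (w := Units.mk0 x hx)]
    · exact hχ _ (by simpa using hpos)
    · simp only [Units.val_mk0]
      field_simp
  · have hpos : 0 < padicValRat p (x ^ 2 / W.a₄) := by
      rw [padicValRat.div hx2 ha0, ha, hv2]; omega
    have h1 := (padicValRat_one_add hpos).1
    have : Units.mk0 (x ^ 2 + W.a₄) h' = Units.mk0 W.a₄ ha0 * Units.mk0 _ h1 :=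
      Units.ext (by simp only [Units.val_mul, Units.val_mk0]; field_simp; ring)
    rw [this, ofMul_mul, map_add, hχ (Units.mk0 _ h1) (by simpa using hpos), add_zero]
    exact hχa

/-- This combination of residue class and valuation kills 1 + pℤ₍ₚ₎, and it kills a because v(a) =
1; so it vanishes on the local image. -/
lemma descentHom_residueHom_add {p : ℕ} [Fact p.Prime] (ha : padicValRat p W.a₄ = 1)
    (P : W.toAffine.Point) :
    descentHom (residueHom p) ZMod.two_nsmul_eq_zero P + residueHom p (a₄Unit W) *
      descentHom (valHom p) ZMod.two_nsmul_eq_zero P = 0 := by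
  refine descentHom_eq_zero_of_padicValRat_eq_one
    (residueHom p + (AddMonoidHom.mulLeft (residueHom p (a₄Unit W))).comp (valHom p))
    (fun u hu ↦ ?_) ha ?_ P
  · have h₁ : residueHom p (.ofMul u) = 0 := by
      refine if_pos ?_
      have := unitResidue_one_add hu
      rw [add_sub_cancel] at this
      rw [toMul_ofMul, this, map_one]
    have h₂ : valHom p (.ofMul u) = 0 := by
      have := (padicValRat_one_add hu).2
      rw [add_sub_cancel] at this
      exact valHom_eq_zero_of_even (by rw [this]; exact Even.zero)
    simp [h₁, h₂]
  · have : valHom p (a₄Unit W) = 1 := by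
      change ((padicValRat p W.a₄ : ℤ) : ZMod 2) = 1
      rw [ha, Int.cast_one]
    rw [AddMonoidHom.add_apply, AddMonoidHom.comp_apply, this, AddMonoidHom.coe_mulLeft, mul_one,
      ← two_nsmul, ZMod.two_nsmul_eq_zero]

/-- If `a = 9 c` with `c ≡ 1` modulo `3` then the descent map of `y² = x³ + a x` is unramified
at `3`. -/
lemma descentHom_valHom_three_eq_zero {c : ℤ} (ha : W.a₄ = 9 * c) (hc : (c : ZMod 3) = 1)
    (P : W.toAffine.Point) : descentHom (valHom 3) ZMod.two_nsmul_eq_zero P = 0 := by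
  have ha0 := a₄_ne_zero (W := W)
  have hc0 : (c : ℚ) ≠ 0 := by rintro h; rw [ha, h] at ha0; simp at ha0
  have hc3 : padicValRat 3 (c : ℚ) = 0 := by
    rw [padicValRat.of_int, padicValInt.eq_zero_of_not_dvd, Nat.cast_zero]
    intro h
    rw [← ZMod.intCast_zmod_eq_zero_iff_dvd] at h
    exact absurd (h.symm.trans hc) (by decide)
  have h9 : padicValRat 3 (9 : ℚ) = 2 := by
    rw [show (9 : ℚ) = ((3 : ℕ) : ℚ) ^ 2 by norm_num, padicValRat.pow,
      padicValRat.self (by norm_num)]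
    norm_num
  have hva : padicValRat 3 W.a₄ = 2 := by
    rw [ha, padicValRat.mul (by norm_num) hc0, h9, hc3, add_zero]
  rcases P with _ | ⟨x, y, h⟩
  · exact map_zero _
  by_cases hx : x = 0
  · rw [descentHom_some_of_eq_zero _ h hx]
    exact valHom_eq_zero_of_even (by rw [Units.val_mk0, hva]; exact even_two)
  rw [descentHom_some _ h hx]
  have hx2 : x ^ 2 ≠ 0 := pow_ne_zero 2 hx
  have hv2 : padicValRat 3 (x ^ 2) = 2 * padicValRat 3 x := by rw [padicValRat.pow]; norm_num
  -- In the only tie, v(x) = 1, put s = x/3. Then x² + a = 9(s² + c) with s² + c ≡ 2 modulo 3, so no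
  -- cancellation occurs.
  have h1 : padicValRat 3 x = 1 → x ^ 2 + W.a₄ ≠ 0 ∧ padicValRat 3 (x ^ 2 + W.a₄) = 2 := by
    intro hv
    have h30 : (3 : ℚ) ≠ 0 := by norm_num
    have hs : padicValRat 3 (x / 3) = 0 := by
      rw [padicValRat.div hx h30, hv, show (3 : ℚ) = ((3 : ℕ) : ℚ) by norm_num,
        padicValRat.self (by norm_num)]
      rfl
    have hd := Rat.den_cast_ne_zero_of_padicValRat_nonneg hs.ge
    have hs0 := Rat.cast_zmod_ne_zero_of_padicValRat_eq_zero (div_ne_zero hx h30) hs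
    have hd2 : (((x / 3) ^ 2).den : ZMod 3) ≠ 0 :=
      Rat.den_cast_ne_zero_of_padicValRat_nonneg (by rw [padicValRat.pow, hs]; simp)
    have hz : (((x / 3) ^ 2 + c : ℚ) : ZMod 3) ≠ 0 := by
      rw [Rat.cast_add_of_ne_zero hd2 (by simp), sq, Rat.cast_mul_of_ne_zero hd hd,
        Rat.cast_intCast, hc]
      generalize ((x / 3 : ℚ) : ZMod 3) = s at hs0
      revert s; decide
    have hz0 : (x / 3) ^ 2 + c ≠ 0 := fun h0 ↦ hz (by rw [h0, Rat.cast_zero])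
    have hzv : padicValRat 3 ((x / 3) ^ 2 + c) = 0 := by
      by_contra hne
      have hnonneg : 0 ≤ padicValRat 3 ((x / 3) ^ 2 + c) := by
        have := padicValRat.min_le_padicValRat_add (p := 3) hz0
        rwa [padicValRat.pow, hs, hc3, mul_zero, min_self] at this
      exact hz (Rat.cast_zmod_eq_zero_of_padicValRat_pos (lt_of_le_of_ne hnonneg (Ne.symm hne)))
    have e : x ^ 2 + W.a₄ = 9 * ((x / 3) ^ 2 + c) := by rw [ha]; ring
    rw [e, padicValRat.mul (by norm_num) hz0, h9, hzv]
    exact ⟨mul_ne_zero (by norm_num) hz0, rfl⟩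
  by_cases h' : x ^ 2 + W.a₄ = 0
  · rw [show x ^ 2 = -W.a₄ by linear_combination h', padicValRat.neg, hva] at hv2
    exact absurd h' (h1 (by omega)).1
  rw [hom_eq_hom_sq_add _ h hx h']
  refine valHom_eq_zero_of_even ?_
  rw [Units.val_mk0]
  rcases lt_trichotomy (padicValRat 3 x) 1 with hv | hv | hv
  · rw [padicValRat.add_eq_of_lt h' hx2 ha0 (by rw [hv2, hva]; omega), hv2]
    exact even_two_mul _
  · rw [(h1 hv).2]
    exact even_two
  · rw [add_comm, padicValRat.add_eq_of_lt (by rwa [add_comm]) ha0 hx2 (by rw [hv2, hva]; omega),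
      hva]
    exact even_two

/-! ### Rational torsion by 2-adic valuations. -/

omit [W.IsX3AddX] [W.IsElliptic] in
-- Odd squares are 1 modulo 4, so after clearing denominators x² − c is 2 modulo 4 and x² + c is 0
-- modulo 4.
lemma padicValRat_two_sq_add_sub {x : ℚ} {c : ℤ} (hx : x ≠ 0) (hv : padicValRat 2 x = 0)
    (hc : c % 4 = 3) :
    x ^ 2 - c ≠ 0 ∧ padicValRat 2 (x ^ 2 - c) = 1 ∧
      (x ^ 2 + c ≠ 0 → 2 ≤ padicValRat 2 (x ^ 2 + c)) := by
  have hd : ¬ (2 : ℤ) ∣ x.den := by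
    have := Rat.den_cast_ne_zero_of_padicValRat_nonneg hv.ge
    rw [Ne, ZMod.natCast_eq_zero_iff] at this
    exact_mod_cast this
  have hn : ¬ (2 : ℤ) ∣ x.num := by
    have := Rat.cast_zmod_ne_zero_of_padicValRat_eq_zero hx hv
    intro h
    rw [Rat.cast_def, (ZMod.intCast_zmod_eq_zero_iff_dvd _ 2).2 (by exact_mod_cast h),
      zero_div] at this
    exact this rfl
  have hdQ : (x.den : ℚ) ≠ 0 := by exact_mod_cast x.den_nz
  have hvd : padicValRat 2 ((x.den : ℚ) ^ 2) = 0 := by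
    rw [padicValRat.pow, padicValRat.of_nat, padicValNat.eq_zero_of_not_dvd (by exact_mod_cast hd)]
    simp
  have h2 : padicValRat 2 (2 : ℚ) = 1 := by
    have := padicValRat.self (p := 2) one_lt_two
    exact_mod_cast this
  set m := x.num with hm
  set n : ℤ := (x.den : ℤ) with hn'
  have hm4 : m ^ 2 % 4 = 1 := by
    have : m % 4 = 1 ∨ m % 4 = 3 := by omega
    rcases this with h | h <;> rw [sq, Int.mul_emod, h] <;> rfl
  have hn4 : n ^ 2 % 4 = 1 := by
    have : n % 4 = 1 ∨ n % 4 = 3 := by omega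
    rcases this with h | h <;> rw [sq, Int.mul_emod, h] <;> rfl
  have hcn : c * n ^ 2 % 4 = 3 := by rw [Int.mul_emod, hn4, hc]; rfl
  have hx2 : x ^ 2 = (m : ℚ) ^ 2 / (x.den : ℚ) ^ 2 := by
    rw [← div_pow, Rat.num_div_den]
  have e₁ : x ^ 2 - c = ((m ^ 2 - c * n ^ 2 : ℤ) : ℚ) / (x.den : ℚ) ^ 2 := by
    rw [hx2]; push_cast [hn']; field_simp
  have e₂ : x ^ 2 + c = ((m ^ 2 + c * n ^ 2 : ℤ) : ℚ) / (x.den : ℚ) ^ 2 := by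
    rw [hx2]; push_cast [hn']; field_simp
  obtain ⟨k, hk⟩ : ∃ k, m ^ 2 - c * n ^ 2 = 2 * k := ⟨(m ^ 2 - c * n ^ 2) / 2, by omega⟩
  obtain ⟨l, hl⟩ : ∃ l, m ^ 2 + c * n ^ 2 = 4 * l := ⟨(m ^ 2 + c * n ^ 2) / 4, by omega⟩
  have hk2 : ¬ (2 : ℤ) ∣ k := by omega
  have hk0 : (k : ℚ) ≠ 0 := by rintro h; norm_cast at h; omega
  rw [e₁, e₂, hk, hl]
  push_cast
  refine ⟨by positivity, ?_, fun h0 ↦ ?_⟩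
  · rw [padicValRat.div (by positivity) (by positivity), hvd,
      padicValRat.mul (_root_.two_ne_zero) hk0, h2,
      padicValRat.of_int, padicValInt.eq_zero_of_not_dvd (by exact_mod_cast hk2)]
    rfl
  · have hl0 : (l : ℚ) ≠ 0 := by rintro h; rw [h] at h0; simp at h0
    rw [padicValRat.div (by positivity) (by positivity), hvd, show (4 : ℚ) = 2 ^ 2 by norm_num,
      padicValRat.mul (by norm_num) hl0, padicValRat.pow, h2, padicValRat.of_int]
    push_cast
    omega

/-- The `2`-adic valuation of the `x`-coordinate of a point. -/
def xVal : W.toAffine.Point → ℤ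
  -- With this default at infinity, a negative value excludes the zero point.
  | 0 => 0
  | .some x _ _ => padicValRat 2 x

/-- From x(2P) = (x² − a)² / (4x(x² + a)): for v = v(x) the valuation is v − 2 if v < 0, at most −2
if v = 0, and −2 − v if v > 0. -/
lemma xVal_two_nsmul {c : ℤ} (ha : W.a₄ = c) (hc : c % 4 = 3) {x y : ℚ}
    (h : W.toAffine.Nonsingular x y) (hy : y ≠ 0) :
    xVal (2 • Affine.Point.some x y h) < 0 ∧ (padicValRat 2 x < 0 →
      xVal (2 • Affine.Point.some x y h) = padicValRat 2 x - 2) := by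
  have e := (nonsingular_iff W).1 h
  have hx : x ≠ 0 := by rintro rfl; simp_all
  have hx2 : x ^ 2 ≠ 0 := pow_ne_zero 2 hx
  have ha0 := a₄_ne_zero (W := W)
  have hva : padicValRat 2 W.a₄ = 0 := by
    rw [ha, padicValRat.of_int, padicValInt.eq_zero_of_not_dvd, Nat.cast_zero]
    omega
  have h' : x ^ 2 + W.a₄ ≠ 0 := by
    intro h0
    have : y ^ 2 = 0 := by linear_combination e + x * h0
    exact hy (by simpa using this)
  have hy' : y ≠ W.toAffine.negY x y := by
    rw [negY]
    intro h'
    exact hy (by linarith)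
  have hX : xVal (2 • Affine.Point.some x y h) =
      padicValRat 2 ((x ^ 2 - W.a₄) ^ 2 / (2 ^ 2 * (x * (x ^ 2 + W.a₄)))) := by
    rw [two_nsmul, Affine.Point.add_self_of_Y_ne hy']
    change padicValRat 2 (W.toAffine.addX _ _ _) = _
    rw [addX, slope_self hy]
    congr 1
    field_simp
    rw [e]
    ring
  have h2 : padicValRat 2 (2 : ℚ) = 1 := by
    have := padicValRat.self (p := 2) one_lt_two
    exact_mod_cast this
  have hv2 : padicValRat 2 (x ^ 2) = 2 * padicValRat 2 x := by rw [padicValRat.pow]; norm_num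
  have key (h₀ : x ^ 2 - W.a₄ ≠ 0) : xVal (2 • Affine.Point.some x y h) =
      2 * padicValRat 2 (x ^ 2 - W.a₄) - (2 + (padicValRat 2 x + padicValRat 2 (x ^ 2 + W.a₄))) := by
    rw [hX, padicValRat.div (pow_ne_zero 2 h₀) (mul_ne_zero (by norm_num) (mul_ne_zero hx h')),
      padicValRat.mul (by norm_num) (mul_ne_zero hx h'), padicValRat.mul hx h', padicValRat.pow,
      padicValRat.pow, h2]
    push_cast
    ring
  have hneg : padicValRat 2 (-W.a₄) = 0 := by rw [padicValRat.neg, hva]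
  have hne (hv : padicValRat 2 x ≠ 0) : x ^ 2 - W.a₄ ≠ 0 := by
    intro h0
    rw [sub_eq_zero.1 h0, hva] at hv2
    omega
  rcases lt_trichotomy (padicValRat 2 x) 0 with hv | hv | hv
  · have hs := hne hv.ne
    have h₁ : padicValRat 2 (x ^ 2 - W.a₄) = 2 * padicValRat 2 x := by
      rw [sub_eq_add_neg] at hs ⊢
      rw [padicValRat.add_eq_of_lt hs hx2 (neg_ne_zero.2 ha0) (by rw [hv2, hneg]; omega), hv2]
    have h₂ : padicValRat 2 (x ^ 2 + W.a₄) = 2 * padicValRat 2 x := by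
      rw [padicValRat.add_eq_of_lt h' hx2 ha0 (by rw [hv2, hva]; omega), hv2]
    rw [key hs, h₁, h₂]
    omega
  · obtain ⟨h₁, h₂, h₃⟩ := padicValRat_two_sq_add_sub hx hv hc
    rw [← ha] at h₁ h₂ h₃
    rw [key h₁, h₂, hv]
    have := h₃ h'
    omega
  · have hs := hne hv.ne'
    have h₁ : padicValRat 2 (x ^ 2 - W.a₄) = 0 := by
      rw [sub_eq_neg_add] at hs ⊢
      rw [padicValRat.add_eq_of_lt hs (neg_ne_zero.2 ha0) hx2 (by rw [hv2, hneg]; omega), hneg]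
    have h₂ : padicValRat 2 (x ^ 2 + W.a₄) = 0 := by
      rw [add_comm] at h' ⊢
      rw [padicValRat.add_eq_of_lt h' ha0 hx2 (by rw [hv2, hva]; omega), hva]
    rw [key hs, h₁, h₂]
    omega

/-- Each doubling lowers the valuation by 2, so the points 2ᵏP are pairwise distinct. -/
lemma not_isOfFinAddOrder_of_xVal_neg {c : ℤ} (ha : W.a₄ = c) (hc : c % 4 = 3)
    (hpos : 0 < W.a₄) {P : W.toAffine.Point} (hP : xVal P < 0) : ¬ IsOfFinAddOrder P := by
  have step (Q : W.toAffine.Point) (hQ : xVal Q < 0) : xVal (2 • Q) = xVal Q - 2 := by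
    rcases Q with _ | ⟨x, y, h⟩
    · exact absurd hQ (lt_irrefl _)
    have hx : x ≠ 0 := by rintro rfl; simp [xVal] at hQ
    refine (xVal_two_nsmul ha hc h ?_).2 hQ
    rintro rfl
    have e := (nonsingular_iff W).1 h
    have : x * (x ^ 2 + W.a₄) = 0 := by linear_combination -e
    rcases mul_eq_zero.1 this with h0 | h0
    · exact hx h0
    · exact absurd h0 (by positivity)
  have hk (k : ℕ) : xVal (2 ^ k • P) = xVal P - 2 * k := by
    induction k with
    | zero => simp
    | succ k ih => rw [pow_succ', mul_smul, step _ (by omega), ih]; push_cast; ring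
  intro hfin
  have : Finite (AddSubmonoid.multiples P) := (finite_multiples.2 hfin).to_subtype
  let f : ℕ → AddSubmonoid.multiples P := fun k ↦ ⟨2 ^ k • P, 2 ^ k, rfl⟩
  refine not_injective_infinite_finite f fun k l hkl ↦ ?_
  have h : 2 ^ k • P = 2 ^ l • P := congrArg Subtype.val hkl
  have := congrArg xVal h
  rw [hk, hk] at this
  omega

/-- The torsion points of `y² = x³ + a x` for a positive integer `a ≡ 3` modulo `4`. -/
lemma eq_zero_or_of_isOfFinAddOrder {c : ℤ} (ha : W.a₄ = c) (hc : c % 4 = 3)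
    (hpos : 0 < W.a₄) {P : W.toAffine.Point} (hP : IsOfFinAddOrder P) :
    P = 0 ∨ ∃ h, P = .some 0 0 h := by
  rcases P with _ | ⟨x, y, h⟩
  · exact Or.inl rfl
  right
  have e := (nonsingular_iff W).1 h
  by_cases hy : y = 0
  · have : x * (x ^ 2 + W.a₄) = 0 := by rw [hy] at e; linear_combination -e
    have hx := (mul_eq_zero.1 this).resolve_right (by positivity)
    subst hx hy
    exact ⟨h, rfl⟩
  · exact absurd (hP.nsmul (n := 2)) (not_isOfFinAddOrder_of_xVal_neg ha hc hpos
      (xVal_two_nsmul ha hc h hy).1)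

end WeierstrassCurve.IsX3AddX

/-! ### The rank formula for a pair of isogenies. -/

/-- The rank of an abelian group `A` from the images of the two descent maps attached to a pair of
homomorphisms `φ : A → B`, `ψ : B → A` with composition multiplication by `2`. -/
theorem finrank_eq_of_descent {A B : Type*} [AddCommGroup A] [AddCommGroup B] {φ : A →+ B}
    {ψ : B →+ A} (hψφ : ∀ a, ψ (φ a) = 2 • a) {n m : ℕ} {α : A →+ (Fin n → ZMod 2)}
    {β : B →+ (Fin m → ZMod 2)} (hα : Function.Surjective α) (hβ : Function.Surjective β)
    (hαψ : α.ker = ψ.range) (hβφ : β.ker = φ.range) {T : A} {T' : B}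
    (hψ : ∀ b, ψ b = 0 ↔ b = 0 ∨ b = T') (hT' : β T' ≠ 0)
    (htors : ∀ a : A, IsOfFinAddOrder a ↔ a = 0 ∨ a = T) (hT : α T ≠ 0)
    (hfg : (nsmulAddMonoidHom (α := A) 2).range.FiniteIndex → AddGroup.FG A) :
    Module.Finite ℤ A ∧ Module.finrank ℤ A + 2 = n + m := by
  have h2 {k : ℕ} (v : Fin k → ZMod 2) : 2 • v = 0 := by
    ext i
    exact ZMod.two_nsmul_eq_zero (v i)
  have hcard (k : ℕ) : Nat.card (Fin k → ZMod 2) = 2 ^ k := by simp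
  set D : AddSubgroup A := (nsmulAddMonoidHom (α := A) 2).range with hD
  have hDmap : D = φ.range.map ψ := by
    ext a
    simp [hD, hψφ]
  have hψindex : ψ.range.index = 2 ^ n := by
    rw [← hαψ, AddSubgroup.index_ker, AddMonoidHom.range_eq_top.2 hα]
    simp
  have hkψ : ψ.ker = AddSubgroup.zmultiples T' := by
    have h2T : 2 • T' = 0 := by
      have h0 : ψ (2 • T') = 0 := by rw [map_nsmul, (hψ T').2 (Or.inr rfl), smul_zero]
      rcases (hψ _).1 h0 with h | h
      · exact h
      · rw [two_nsmul, add_eq_left] at h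
        rw [h, smul_zero]
    apply le_antisymm
    · intro b hb
      rcases (hψ b).1 hb with rfl | rfl
      · exact zero_mem _
      · exact AddSubgroup.mem_zmultiples _
    · rw [AddSubgroup.zmultiples_le]
      exact (hψ T').2 (Or.inr rfl)
  -- As T' lies outside ker β = φ(A), adjoining ker ψ = ⟨T'⟩ to φ(A) halves its index 2ᵐ.
  have hindex : 2 * (φ.range ⊔ ψ.ker).index = 2 ^ m := by
    have e : (φ.range ⊔ ψ.ker).map β = AddSubgroup.zmultiples (β T') := by
      rw [AddSubgroup.map_sup, ← hβφ, hkψ, AddMonoidHom.map_zmultiples,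
        (AddSubgroup.map_eq_bot_iff _).2 le_rfl, bot_sup_eq]
    rw [← AddSubgroup.index_map_eq (f := β) _ hβ (by rw [hβφ]; exact le_sup_left), e,
      ← hcard, ← AddSubgroup.card_mul_index (AddSubgroup.zmultiples (β T')), Nat.card_zmultiples,
      addOrderOf_eq_prime (h2 _) hT']
  -- Here 2A = ψ(φ(A)), so [A : 2A] = [A : ψ(B)] · [B : φ(A) + ker ψ].
  have hDindex : 2 * D.index = 2 ^ (n + m) := by
    rw [hDmap, AddSubgroup.index_map, hψindex, pow_add, ← hindex]
    ring
  have hfin : D.FiniteIndex := ⟨fun h ↦ by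
    rw [h, mul_zero] at hDindex
    exact pow_ne_zero _ two_ne_zero hDindex.symm⟩
  have hFG := hfg hfin
  have hfinite : Module.Finite ℤ A := Module.Finite.iff_addGroup_fg.2 hFG
  refine ⟨hfinite, ?_⟩
  set K : AddSubgroup A := AddSubgroup.zmultiples T with hK
  have hT0 : T ≠ 0 := by rintro rfl; exact hT (map_zero α)
  have hTfin : IsOfFinAddOrder T := (htors T).2 (Or.inr rfl)
  have hKtors : K = (Submodule.torsion ℤ A).toAddSubgroup := by
    rw [Submodule.torsion_int]
    apply le_antisymm
    · rw [hK, AddSubgroup.zmultiples_le]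
      exact hTfin
    · intro a ha
      rcases (htors a).1 ha with rfl | rfl
      · exact zero_mem _
      · exact AddSubgroup.mem_zmultiples _
  have h2T : 2 • T = 0 := by
    rcases (htors _).1 (hTfin.nsmul (n := 2)) with h | h
    · exact h
    · rw [two_nsmul, add_eq_left] at h
      exact absurd h hT0
  have hKcard : Nat.card K = 2 := by
    rw [Nat.card_zmultiples, addOrderOf_eq_prime h2T hT0]
  -- The map α kills 2A but not T.
  have hDK : D ⊓ K = ⊥ := by
    rw [eq_bot_iff]
    rintro a ⟨⟨b, hb⟩, ha⟩
    rw [hKtors, Submodule.torsion_int] at ha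
    rcases (htors a).1 ha with rfl | rfl
    · exact zero_mem _
    · exact absurd (by rw [← hb, nsmulAddMonoidHom_apply, map_nsmul, h2]) hT
  have hrel : D.index = 2 * (D ⊔ K).index := by
    rw [← AddSubgroup.relIndex_mul_index (le_sup_left : D ≤ D ⊔ K), AddSubgroup.relIndex_sup_left,
      ← AddSubgroup.inf_relIndex_right, hDK, AddSubgroup.relIndex_bot_left, hKcard]
  -- Modulo torsion, A is free of rank r, so [A : 2A + ⟨T⟩] = 2ʳ and [A : 2A] = 2ʳ⁺¹.
  let π : A →+ A ⧸ Submodule.torsion ℤ A := (Submodule.mkQ _).toAddMonoidHom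
  have hπ : Function.Surjective π := Submodule.mkQ_surjective _
  have hπK : π.ker = K := by
    rw [hKtors]
    ext a
    exact Submodule.Quotient.mk_eq_zero _
  have hπD : D.map π = (nsmulAddMonoidHom (α := A ⧸ Submodule.torsion ℤ A) 2).range := by
    ext x
    constructor
    · rintro ⟨_, ⟨a, rfl⟩, rfl⟩
      exact ⟨π a, by simp⟩
    · rintro ⟨y, rfl⟩
      obtain ⟨a, rfl⟩ := hπ y
      exact ⟨2 • a, ⟨a, rfl⟩, by simp⟩
  have hfree : Module.Free ℤ (A ⧸ Submodule.torsion ℤ A) := inferInstance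
  have h1 := AddSubgroup.index_range_nsmul (A ⧸ Submodule.torsion ℤ A) 2
  rw [← hπD, AddSubgroup.index_map, hπK, AddMonoidHom.range_eq_top.2 hπ, AddSubgroup.index_top,
    mul_one, finrank_quotient_eq_of_le_torsion le_rfl] at h1
  rw [hrel, h1, ← mul_assoc, mul_comm, show 2 * 2 = 2 ^ 2 from rfl, ← pow_add] at hDindex
  exact Nat.pow_right_injective le_rfl hDindex

/-! ### Computable residue symbols. -/

section Residue

/-- The class in `ZMod 2` of an integer modulo a prime `p`: zero for squares. -/
def residueClass (p : ℕ) (z : ℤ) : ZMod 2 :=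
  if (z % p).toNat ^ (p / 2) % p = 1 then 0 else 1

lemma unitResidue_intCast {p : ℕ} [Fact p.Prime] {z : ℤ} (hz : ¬ (p : ℤ) ∣ z) :
    unitResidue p z = z := by
  rw [unitResidue_eq_cast, Rat.cast_intCast]
  rw [padicValRat.of_int, padicValInt.eq_zero_of_not_dvd hz, Nat.cast_zero]

lemma unitResidue_prime_mul {p : ℕ} [Fact p.Prime] {z : ℤ} (hz : ¬ (p : ℤ) ∣ z) :
    unitResidue p (p * z) = z := by
  have hp : (p : ℚ) ≠ 0 := by exact_mod_cast (Fact.out : p.Prime).ne_zero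
  have hz0 : (z : ℚ) ≠ 0 := by rintro h; norm_cast at h; simp [h] at hz
  rw [unitResidue_mul hp hz0, unitResidue_intCast hz, unitResidue, padicValRat.self
    (Fact.out : p.Prime).one_lt, zpow_neg, zpow_one, mul_inv_cancel₀ hp, Rat.cast_one, one_mul]

/-- Euler's criterion, in a form that evaluates by natural number arithmetic. -/
lemma quadraticChar_intCast_eq_one_iff {p : ℕ} [Fact p.Prime] {z : ℤ}
    (hz : ¬ (p : ℤ) ∣ z) :
    quadraticChar (ZMod p) z = 1 ↔ (z % p).toNat ^ (p / 2) % p = 1 := by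
  have hp := (Fact.out : p.Prime)
  have hz0 : (z : ZMod p) ≠ 0 := by rwa [Ne, ZMod.intCast_zmod_eq_zero_iff_dvd]
  have hcast : (z : ZMod p) = ((z % p).toNat : ℕ) := by
    rw [← Int.cast_natCast, Int.toNat_of_nonneg (Int.emod_nonneg _ (by exact_mod_cast hp.ne_zero)),
      ZMod.intCast_mod]
  rw [quadraticChar_one_iff_isSquare hz0, ZMod.euler_criterion p hz0, hcast, ← Nat.cast_pow,
    ← Nat.cast_one, ZMod.natCast_eq_natCast_iff', Nat.mod_eq_of_lt hp.one_lt]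

lemma residueHom_of_unitResidue_eq {p : ℕ} [Fact p.Prime] {z : ℤ}
    (hz : ¬ (p : ℤ) ∣ z) {u : Additive ℚˣ} (hu : unitResidue p (u.toMul : ℚˣ) = z) :
    residueHom p u = residueClass p z := by
  change (if quadraticChar (ZMod p) (unitResidue p (u.toMul : ℚˣ)) = 1 then 0 else 1) = _
  simp only [hu, quadraticChar_intCast_eq_one_iff hz, residueClass]

lemma residueHom_eq_residueClass {p : ℕ} [Fact p.Prime] {z : ℤ}
    (hz : ¬ (p : ℤ) ∣ z) {u : Additive ℚˣ} (hu : ((u.toMul : ℚˣ) : ℚ) = z) :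
    residueHom p u = residueClass p z :=
  residueHom_of_unitResidue_eq hz (by rw [hu, unitResidue_intCast hz])

lemma residueHom_eq_residueClass_of_prime_mul {p : ℕ} [Fact p.Prime] {z : ℤ}
    (hz : ¬ (p : ℤ) ∣ z) {u : Additive ℚˣ} (hu : ((u.toMul : ℚˣ) : ℚ) = p * z) :
    residueHom p u = residueClass p z :=
  residueHom_of_unitResidue_eq hz (by rw [hu, unitResidue_prime_mul hz])

lemma valHom_intCast {p : ℕ} [Fact p.Prime] {z : ℤ} (h : ¬ ((p : ℤ) ^ 2) ∣ z) {u : Additive ℚˣ}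
    (hu : ((u.toMul : ℚˣ) : ℚ) = z) : valHom p u = if (p : ℤ) ∣ z then 1 else 0 := by
  change ((padicValRat p ((u.toMul : ℚˣ) : ℚ) : ℤ) : ZMod 2) = _
  have hz : z ≠ 0 := by rintro rfl; exact h (dvd_zero _)
  rw [hu, padicValRat.of_int]
  split_ifs with hd
  · have : padicValInt p z = 1 := by
      rw [padicValInt]
      have h₁ := one_le_padicValNat_of_dvd (Int.natAbs_ne_zero.2 hz) (Int.natCast_dvd.1 hd)
      have h₂ : ¬ 2 ≤ padicValNat p z.natAbs := by
        rw [← padicValNat_dvd_iff_le (Int.natAbs_ne_zero.2 hz)]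
        rwa [← Int.natCast_dvd, Nat.cast_pow]
      omega
    rw [this]; rfl
  · rw [padicValInt.eq_zero_of_not_dvd hd]; rfl

end Residue

namespace WeierstrassCurve.IsX3AddX

/-- The local condition at a prime `q j` that divides `a` exactly once. -/
lemma residueClass_mul_add_sum {W : WeierstrassCurve ℚ} [W.IsX3AddX] [W.IsElliptic] {a : ℤ}
    {ι : Type*} [Fintype ι] [DecidableEq ι] {q : ι → ℕ} [∀ i, Fact (q i).Prime]
    (hq : Function.Injective q) (haW : W.a₄ = a)
    (hout : ∀ r [Fact r.Prime], r ∉ Set.range q → padicValRat r (a : ℚ) = 0) {j : ι}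
    (hdvd : a % q j = 0) (hndvd : a / q j % q j ≠ 0) (P : W.toAffine.Point) :
    residueClass (q j) (-1) * descentHom ratSignHom ZMod.two_nsmul_eq_zero P +
      ∑ i, residueClass (q j) (if i = j then a / q j else q i) *
        descentHom (valHom (q i)) ZMod.two_nsmul_eq_zero P = 0 := by
  have hpp : (q j).Prime := Fact.out
  have hndvd' : ¬ (q j : ℤ) ∣ a / q j := fun h ↦ hndvd (Int.emod_eq_zero_of_dvd h)
  have hmul : (a : ℚ) = (q j : ℚ) * ((a / q j : ℤ) : ℚ) := by
    rw [← Int.cast_natCast, ← Int.cast_mul, Int.mul_ediv_cancel' (Int.dvd_of_emod_eq_zero hdvd)]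
  have hval : padicValRat (q j) W.a₄ = 1 := by
    rw [haW, hmul, padicValRat.mul (by exact_mod_cast hpp.ne_zero)
      (by rintro h; norm_cast at h; simp [h] at hndvd'), padicValRat.self hpp.one_lt,
      padicValRat.of_int, padicValInt.eq_zero_of_not_dvd hndvd']
    rfl
  have key := descentHom_residueHom_add hval P
  have hra : residueHom (q j) (a₄Unit W) = residueClass (q j) (a / q j) :=
    residueHom_eq_residueClass_of_prime_mul hndvd' (by rw [← hmul, ← haW]; rfl)
  have hram (r : ℕ) (hr : Fact r.Prime) (h : r ∉ Set.range q) :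
      descentHom (valHom r) ZMod.two_nsmul_eq_zero P = 0 :=
    descentHom_valHom_eq_zero (by rw [haW]; exact hout r h) P
  let b (i : ι) : Additive ℚˣ :=
    .ofMul (Units.mk0 (q i : ℚ) (by exact_mod_cast (Fact.out : (q i).Prime).ne_zero))
  have hsum := hom_eq_sum hq (residueHom (q j))
    (.ofMul (Units.mk0 _ (descentRep_ne_zero P))) hram b (fun i ↦ rfl)
  have h1 : ¬ (q j : ℤ) ∣ 1 := by exact_mod_cast hpp.one_lt.ne' ∘ Nat.dvd_one.1
  have hone : residueHom (q j) (.ofMul (-1)) = residueClass (q j) (-1) :=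
    residueHom_eq_residueClass (by rwa [Int.dvd_neg]) (by simp)
  have hb (i : ι) (hi : i ≠ j) : residueHom (q j) (b i) = residueClass (q j) (q i) :=
    residueHom_eq_residueClass (by
      rw [Int.natCast_dvd_natCast, Nat.prime_dvd_prime_iff_eq hpp Fact.out]
      exact fun e ↦ hi (hq e.symm)) rfl
  -- The unit part of q j at itself is 1. The entry a / q j in column j therefore comes only from
  -- the correction term of `descentHom_residueHom_add`.
  have hbj : residueHom (q j) (b j) = 0 := by
    rw [residueHom_eq_residueClass_of_prime_mul (z := 1) h1 (by simp [b]), residueClass,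
      Int.emod_eq_of_lt zero_le_one (by exact_mod_cast hpp.one_lt), Int.toNat_one, one_pow,
      if_pos (Nat.mod_eq_of_lt hpp.one_lt)]
  have hterm (i : ι) : residueClass (q j) (if i = j then a / q j else q i) *
        descentHom (valHom (q i)) ZMod.two_nsmul_eq_zero P =
      valHom (q i) (.ofMul (Units.mk0 _ (descentRep_ne_zero P))) * residueHom (q j) (b i) +
        if i = j then residueClass (q j) (a / q j) *
          descentHom (valHom (q j)) ZMod.two_nsmul_eq_zero P else 0 := by
    by_cases h : i = j
    · subst h
      rw [if_pos rfl, if_pos rfl, hbj, mul_zero, zero_add]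
    · rw [if_neg h, if_neg h, hb i h, add_zero, mul_comm]
      rfl
  rw [hra] at key
  simp only [hterm, ← hone, Finset.sum_add_distrib, Finset.sum_ite_eq', Finset.mem_univ, if_true]
  rw [← add_assoc, ← key]
  congr 1
  rw [mul_comm]
  exact hsum.symm

end WeierstrassCurve.IsX3AddX

/-! ### The linear system over 𝔽₂. -/

/-- The primes of bad reduction of the curve of Watkins. -/
def badPrime : Fin 19 → ℕ :=
  ![2, 3, 7, 11, 17, 19, 23, 37, 59, 71, 73, 97, 127, 139, 151, 263, 313, 443, 733]

instance (i : Fin 19) : Fact (badPrime i).Prime :=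
  ⟨by fin_cases i <;> norm_num [badPrime]⟩

lemma badPrime_injective : Function.Injective badPrime := by
  intro i j h
  revert i j
  decide +kernel

lemma padicValRat_eq_zero_of_notMem_range {a : ℤ} (ha : a.natAbs ∣ (∏ i, badPrime i) ^ 2) (r : ℕ)
    [hr : Fact r.Prime] (h : r ∉ Set.range badPrime) : padicValRat r (a : ℚ) = 0 := by
  rw [padicValRat.of_int, padicValInt.eq_zero_of_not_dvd, Nat.cast_zero]
  intro hra
  have h₁ := hr.out.dvd_of_dvd_pow ((Int.natCast_dvd.1 hra).trans ha)
  obtain ⟨i, -, hi⟩ := (hr.out.prime.dvd_finsetProd_iff _).1 h₁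
  exact h ⟨i, ((Nat.prime_dvd_prime_iff_eq hr.out Fact.out).1 hi).symm⟩

/-- The primes that divide `a` exactly once. -/
abbrev simplePrime (j : Fin 17) : ℕ := badPrime (Fin.natAdd 2 j)

/-- The matrix of the local conditions on the image of the descent map of `y² = x³ + a x`. -/
def localMatrix (a : ℤ) (j : Fin 17) (i : Fin 20) : ZMod 2 :=
  residueClass (simplePrime j)
    -- Column 0 belongs to the sign; column k + 1 belongs to the prime with index k.
    (Fin.cases (-1) (fun k ↦ if k = Fin.natAdd 2 j then a / simplePrime j else badPrime k) i)

/-- The bits of a natural number. -/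
def bit (n j : ℕ) : ZMod 2 := if n.testBit j then 1 else 0

/-- The masks `L` express that the linear system `localMatrix a` determines the coordinates outside
`Z` in terms of the coordinates in `Z`. -/
def IsEliminated (a : ℤ) (Z : Finset (Fin 20)) (L : Fin 20 → ℕ) : Prop :=
  ∀ i, i ∉ Z → ∀ i', i' ∉ Z →
    ∑ j : Fin 17, bit (L i) j * localMatrix a j i' = if i' = i then 1 else 0

instance (a : ℤ) (Z : Finset (Fin 20)) (L : Fin 20 → ℕ) : Decidable (IsEliminated a Z L) :=
  inferInstanceAs (Decidable (∀ _, _))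

/-- `a` is divisible exactly once by all bad primes except `2` and `3`. -/
def IsSimpleOutsideSix (a : ℤ) : Prop :=
  -- The square leaves room for the factor 9 of both coefficients and the factor 4 of −4a.
  a.natAbs ∣ (∏ i, badPrime i) ^ 2 ∧
    ∀ j, a % simplePrime j = 0 ∧ a / simplePrime j % simplePrime j ≠ 0

instance (a : ℤ) : Decidable (IsSimpleOutsideSix a) := inferInstanceAs (Decidable (_ ∧ _))

namespace WeierstrassCurve.IsX3AddX

variable {W : WeierstrassCurve ℚ} [W.IsX3AddX] [W.IsElliptic] {a : ℤ}

/-- The coordinates of the image of the descent map. -/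
noncomputable def descentCoord (W : WeierstrassCurve ℚ) [W.IsX3AddX] [W.IsElliptic] (i : Fin 20) :
    W.toAffine.Point →+ ZMod 2 :=
  descentHom (Fin.cases ratSignHom (fun k ↦ valHom (badPrime k)) i : Additive ℚˣ →+ ZMod 2)
    ZMod.two_nsmul_eq_zero

lemma sum_localMatrix_mul (haW : W.a₄ = a) (ha : IsSimpleOutsideSix a) (j : Fin 17)
    (P : W.toAffine.Point) : ∑ i, localMatrix a j i * descentCoord W i P = 0 := by
  rw [Fin.sum_univ_succ]
  exact residueClass_mul_add_sum badPrime_injective haW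
    (fun r _ ↦ padicValRat_eq_zero_of_notMem_range ha.1 r) (ha.2 j).1
    (ha.2 j).2 P

/-- Adding the local equations selected by the mask `L i` isolates coordinate i once those in Z
vanish. -/
lemma descentCoord_eq_zero (haW : W.a₄ = a) (ha : IsSimpleOutsideSix a) {Z : Finset (Fin 20)}
    {L : Fin 20 → ℕ} (hL : IsEliminated a Z L) {P : W.toAffine.Point}
    (hP : ∀ i ∈ Z, descentCoord W i P = 0) (i : Fin 20) : descentCoord W i P = 0 := by
  by_cases hi : i ∈ Z
  · exact hP i hi
  have h : ∑ j : Fin 17, bit (L i) j * ∑ i', localMatrix a j i' * descentCoord W i' P = 0 :=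
    Finset.sum_eq_zero fun j _ ↦ by rw [sum_localMatrix_mul haW ha j P, mul_zero]
  simp only [Finset.mul_sum, ← mul_assoc] at h
  rw [Finset.sum_comm] at h
  simp only [← Finset.sum_mul] at h
  rw [Finset.sum_eq_single i] at h
  · rwa [hL i hi i hi, if_pos rfl, one_mul] at h
  · intro i' _ hii'
    by_cases hi' : i' ∈ Z
    · rw [hP i' hi', mul_zero]
    · rw [hL i hi i' hi', if_neg hii', zero_mul]
  · exact fun h ↦ absurd (Finset.mem_univ _) h

lemma isSquare_descentRep (haW : W.a₄ = a) (ha : IsSimpleOutsideSix a) {P : W.toAffine.Point}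
    (hP : ∀ i, descentCoord W i P = 0) : IsSquare (descentRep P) := by
  apply Rat.isSquare_of_even_padicValRat
  · by_contra h
    exact one_ne_zero ((if_neg h).symm.trans (hP 0))
  · intro r hr
    have : Fact r.Prime := ⟨hr⟩
    refine even_of_valHom_eq_zero (u := Units.mk0 _ (descentRep_ne_zero P)) ?_
    by_cases h : r ∈ Set.range badPrime
    · obtain ⟨i, rfl⟩ := h
      exact hP i.succ
    · exact descentHom_valHom_eq_zero
        (by rw [haW]; exact padicValRat_eq_zero_of_notMem_range ha.1 r h) P

end WeierstrassCurve.IsX3AddX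

/-! ### Exactness of the two descent sequences, and certificates for the images. -/

namespace WeierstrassCurve.IsX3AddX

section Field

variable {F : Type*} [Field F] [DecidableEq F]

/-- The curve `y² = x³ + a x`. -/
def curve (a : F) : WeierstrassCurve F := ⟨0, 0, 0, a, 0⟩

instance (a : F) : (curve a).IsX3AddX := ⟨rfl, rfl, rfl, rfl⟩

variable (W : WeierstrassCurve F) {W' : WeierstrassCurve F} (W'' : WeierstrassCurve F)
  [W.IsX3AddX] [W.IsElliptic] [W'.IsX3AddX] [W'.IsElliptic] [W''.IsX3AddX] [W''.IsElliptic]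

/-- The point `(0, 0)` of order two. -/
def zeroPoint : W.toAffine.Point := .some 0 0 ((nonsingular_iff W).2 (by simp))

variable {W}

lemma dualIsog_eq_zero_iff (h : W'.a₄ = -4 * W.a₄) (h' : W''.a₄ = -4 * W'.a₄)
    (P : W'.toAffine.Point) : dualIsog W'' h h' P = 0 ↔ P = 0 ∨ P = zeroPoint W' := by
  rcases P with _ | ⟨x, y, hP⟩
  · exact iff_of_true (map_zero _) (Or.inl rfl)
  have e := (nonsingular_iff W').1 hP
  have h0 : x = 0 → y = 0 := by rintro rfl; simpa using e
  by_cases hx : x = 0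
  · refine iff_of_true ?_ (Or.inr ?_)
    · rw [dualIsog, AddMonoidHom.comp_apply, isog_some_of_eq_zero _ _ hx, map_zero]
    · simp [zeroPoint, hx, h0 hx]
  · obtain ⟨_, e⟩ := dualIsog_some W'' h h' hP hx
    rw [e]
    refine iff_of_false (Affine.Point.some_ne_zero _) ?_
    rintro (h | h)
    · exact Affine.Point.some_ne_zero _ h
    · simp only [zeroPoint, Affine.Point.some.injEq] at h
      exact hx h.1

/-- A preimage of (w², wt) is sought as (X, wX), where X² − w²X + a = 0. Its discriminant w⁴ − 4a is
t², which gives X = (w² + t)/2. -/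
lemma mem_range_isog (h : W'.a₄ = -4 * W.a₄) {x y w : F}
    (hP : W'.toAffine.Nonsingular x y) (hx : x ≠ 0) (hw : x = w ^ 2) :
    .some x y hP ∈ (isog h).range := by
  have h2 := two_ne_zero (W := W)
  have ha := a₄_ne_zero (W := W)
  have h4 : (4 : F) = 2 ^ 2 := by norm_num
  have hP' := (nonsingular_iff W').1 hP
  have hw0 : w ≠ 0 := by rintro rfl; simp_all
  obtain ⟨t, rfl⟩ : ∃ t, y = w * t := ⟨y / w, by field_simp⟩
  have hat : 4 * W.a₄ = (w ^ 2 - t) * (w ^ 2 + t) := by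
    have : w ^ 2 * (4 * W.a₄) = w ^ 2 * ((w ^ 2 - t) * (w ^ 2 + t)) := by
      rw [hw, h] at hP'
      linear_combination hP'
    exact mul_left_cancel₀ (pow_ne_zero 2 hw0) this
  obtain ⟨X, rfl⟩ : ∃ X, t = 2 * X - w ^ 2 := ⟨(w ^ 2 + t) / 2, by field_simp; ring⟩
  have hat' : W.a₄ = X * (w ^ 2 - X) := by
    have h40 : (4 : F) ≠ 0 := h4 ▸ pow_ne_zero 2 h2
    refine mul_left_cancel₀ h40 ?_
    linear_combination hat
  have hX : X ≠ 0 := by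
    rintro rfl
    rw [zero_mul] at hat'
    exact ha hat'
  have hR : W.toAffine.Nonsingular X (w * X) := by
    rw [nonsingular_iff, hat']
    ring
  refine ⟨.some _ _ hR, ?_⟩
  rw [isog_some h hR hX]
  simp only [Affine.Point.some.injEq]
  rw [hat', hw]
  constructor
  · field_simp
  · field_simp
    ring

lemma descentRep_isog (h : W'.a₄ = -4 * W.a₄) (P : W.toAffine.Point) :
    ∃ u, descentRep (isog h P) = u ^ 2 := by
  rcases P with _ | ⟨x, y, hP⟩
  · exact ⟨1, by rw [one_pow]; exact congrArg descentRep (map_zero _)⟩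
  by_cases hx : x = 0
  · refine ⟨1, ?_⟩
    rw [isog_some_of_eq_zero _ _ hx, one_pow]
    exact descentRep_zero
  rw [isog_some h hP hx]
  by_cases hy : y = 0
  · refine ⟨2 * x, ?_⟩
    rw [descentRep_some_of_eq_zero _ (by rw [hy]; simp)]
    have := (nonsingular_iff W).1 hP
    rw [hy] at this
    have h0 : x * (x ^ 2 + W.a₄) = 0 := by linear_combination -this
    have h1 := (mul_eq_zero.1 h0).resolve_left hx
    rw [h]
    linear_combination -4 * h1
  · refine ⟨y / x, ?_⟩
    rw [descentRep_some]
    · field_simp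
    · positivity

lemma mem_range_isog_of_isSquare (h : W'.a₄ = -4 * W.a₄) (ha : ¬ IsSquare W'.a₄)
    {P : W'.toAffine.Point} (hP : IsSquare (descentRep P)) : P ∈ (isog h).range := by
  rcases P with _ | ⟨x, y, hP'⟩
  · exact zero_mem _
  by_cases hx : x = 0
  · rw [descentRep_some_of_eq_zero hP' hx] at hP
    exact absurd hP ha
  · rw [descentRep_some hP' hx] at hP
    obtain ⟨w, hw⟩ := hP
    exact mem_range_isog h hP' hx (hw.trans (sq w).symm)

lemma mem_range_dualIsog_of_isSquare (h : W'.a₄ = -4 * W.a₄) (h' : W''.a₄ = -4 * W'.a₄)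
    (ha : ¬ IsSquare W.a₄) {P : W.toAffine.Point} (hP : IsSquare (descentRep P)) :
    P ∈ (dualIsog W'' h h').range := by
  rcases P with _ | ⟨x, y, hP'⟩
  · exact zero_mem _
  by_cases hx : x = 0
  · rw [descentRep_some_of_eq_zero hP' hx] at hP
    exact absurd hP ha
  · rw [descentRep_some hP' hx] at hP
    obtain ⟨w, hw⟩ := hP
    exact mem_range_dualIsog W'' h h' hP' hx (hw.trans (sq w).symm)

end Field

/-- The table `(d, d', X, Z, w)` describes points of `y² = x³ + a x` whose images under the descent
map form a basis dual to the valuations at the bad primes with indices `k`. -/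
def IsDualTable (a : ℤ) (k : Fin 8 → Fin 19) (d d' X Z w : Fin 8 → ℤ) : Prop :=
  ∀ j, d j ≠ 0 ∧ X j ≠ 0 ∧ Z j ≠ 0 ∧ d j * d' j = a ∧
    d j * X j ^ 4 + d' j * Z j ^ 4 = w j ^ 2 ∧
    ∀ i, d j % (badPrime (k i) ^ 2 : ℕ) ≠ 0 ∧ (d j % badPrime (k i) = 0 ↔ i = j)

instance (a : ℤ) (k : Fin 8 → Fin 19) (d d' X Z w : Fin 8 → ℤ) :
    Decidable (IsDualTable a k d d' X Z w) := inferInstanceAs (Decidable (∀ _, _))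

variable (W : WeierstrassCurve ℚ) [W.IsX3AddX] [W.IsElliptic] {a : ℤ}

/-- The coordinates with indices `k` of the descent map. -/
noncomputable def freeCoord (k : Fin 8 → Fin 19) : W.toAffine.Point →+ (Fin 8 → ZMod 2) :=
  AddMonoidHom.pi fun i ↦ descentHom (valHom (badPrime (k i))) ZMod.two_nsmul_eq_zero

variable {W}

/-- A solution of dX⁴ + d'Z⁴ = w² is a point on the 2-covering attached to d; it maps to a point
with x = d(X/Z)², whose class is d. -/
lemma exists_valHom_eq (haW : W.a₄ = a) {d d' X Z w : ℤ} (hd : d ≠ 0) (hX : X ≠ 0) (hZ : Z ≠ 0)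
    (had : d * d' = a) (hw : d * X ^ 4 + d' * Z ^ 4 = w ^ 2) :
    ∃ P : W.toAffine.Point, ∀ (p : ℕ) [Fact p.Prime], ¬ (p : ℤ) ^ 2 ∣ d →
      descentHom (valHom p) ZMod.two_nsmul_eq_zero P = if (p : ℤ) ∣ d then 1 else 0 := by
  have hd' : (d : ℚ) ≠ 0 := by exact_mod_cast hd
  have hX' : (X : ℚ) ≠ 0 := by exact_mod_cast hX
  have hZ' : (Z : ℚ) ≠ 0 := by exact_mod_cast hZ
  have hw' : (d : ℚ) * X ^ 4 + d' * Z ^ 4 = w ^ 2 := by exact_mod_cast hw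
  have ha' : (d : ℚ) * d' = W.a₄ := by rw [haW, ← had, Int.cast_mul]
  have hP : W.toAffine.Nonsingular (d * (X / Z) ^ 2 : ℚ) (d * X * w / Z ^ 3) := by
    rw [nonsingular_iff, ← ha']
    field_simp
    linear_combination -hw'
  have hx : (d * (X / Z) ^ 2 : ℚ) ≠ 0 := mul_ne_zero hd' (pow_ne_zero 2 (div_ne_zero hX' hZ'))
  refine ⟨.some _ _ hP, fun p _ hp ↦ ?_⟩
  rw [descentHom_some _ hP hx, hom_eq_zero_of_sq (v := Units.mk0 (d : ℚ) hd')
    (w := Units.mk0 (X / Z : ℚ) (div_ne_zero hX' hZ')) _ rfl]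
  exact valHom_intCast hp rfl

lemma freeCoord_surjective (haW : W.a₄ = a) {k : Fin 8 → Fin 19} {d d' X Z w : Fin 8 → ℤ}
    (ht : IsDualTable a k d d' X Z w) : Function.Surjective (freeCoord W k) := by
  have (j : Fin 8) : ∃ P, freeCoord W k P = Pi.single j 1 := by
    obtain ⟨hd, hX, hZ, had, hw, hk⟩ := ht j
    obtain ⟨P, hP⟩ := exists_valHom_eq haW hd hX hZ had hw
    refine ⟨P, funext fun i ↦ ?_⟩
    obtain ⟨h₁, h₂⟩ := hk i
    refine (hP _ fun h ↦ h₁ (Int.emod_eq_zero_of_dvd (by exact_mod_cast h))).trans ?_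
    rw [Pi.single_apply]
    refine if_congr ?_ rfl rfl
    rw [Int.dvd_iff_emod_eq_zero, h₂]
  choose P hP using this
  intro v
  refine ⟨∑ j, (v j).val • P j, ?_⟩
  simp only [map_sum, map_nsmul, hP]
  ext i
  simp only [Finset.sum_apply, Pi.smul_apply, Pi.single_apply]
  simp

lemma freeCoord_eq_zero_of_sq {k : Fin 8 → Fin 19} {P : W.toAffine.Point}
    (hP : ∃ u, descentRep P = u ^ 2) : freeCoord W k P = 0 := by
  obtain ⟨u, hu⟩ := hP
  have hu0 : u ≠ 0 := by
    rintro rfl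
    exact descentRep_ne_zero P (by rw [hu, zero_pow (two_ne_zero' ℕ)])
  ext i
  change valHom (badPrime (k i)) (.ofMul (Units.mk0 _ (descentRep_ne_zero P))) = 0
  rw [hom_eq_zero_of_sq (v := 1) (w := Units.mk0 u hu0) _ (by simpa using hu), ofMul_one, map_zero]

omit [W.IsX3AddX] [W.IsElliptic] in
lemma not_isSquare_of_emod_four (ha : a % 4 = 3) : ¬ IsSquare (a : ℚ) := by
  rw [Rat.isSquare_intCast_iff]
  rintro ⟨r, rfl⟩
  have h4 : r % 4 = 0 ∨ r % 4 = 1 ∨ r % 4 = 2 ∨ r % 4 = 3 := by omega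
  rw [Int.mul_emod] at ha
  rcases h4 with h4 | h4 | h4 | h4 <;> simp [h4] at ha

/-- The rank of `y² = x³ + a x` from descent data. -/
theorem finrank_point_add_two {a' : ℤ} {W' W'' : WeierstrassCurve ℚ} [W'.IsX3AddX]
    [W'.IsElliptic] [W''.IsX3AddX] [W''.IsElliptic]
    (h : W'.a₄ = -4 * W.a₄) (h' : W''.a₄ = -4 * W'.a₄) (haW : W.a₄ = a) (haW' : W'.a₄ = a')
    (hpos : 0 < a) (hmod : a % 4 = 3) {k k' : Fin 8 → Fin 19} {d₁ d₂ X Z w : Fin 8 → ℤ}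
    {d₁' d₂' X' Z' w' : Fin 8 → ℤ} (ht : IsDualTable a k d₁ d₂ X Z w)
    (ht' : IsDualTable a' k' d₁' d₂' X' Z' w')
    (hsq : ∀ P, freeCoord W k P = 0 → IsSquare (descentRep P))
    (hsq' : ∀ P, freeCoord W' k' P = 0 → IsSquare (descentRep P)) :
    Module.Finite ℤ W.toAffine.Point ∧ Module.finrank ℤ W.toAffine.Point + 2 = 8 + 8 := by
  have hposW : 0 < W.a₄ := by rw [haW]; exact_mod_cast hpos
  have hW : ¬ IsSquare W.a₄ := by
    rw [haW]
    exact not_isSquare_of_emod_four hmod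
  have hW' : ¬ IsSquare W'.a₄ := fun hs ↦ by
    have := hs.nonneg
    rw [h] at this
    linarith
  refine finrank_eq_of_descent (φ := isog h) (ψ := dualIsog W'' h h') (dualIsog_isog W'' h h')
    (freeCoord_surjective haW ht) (freeCoord_surjective haW' ht') ?_ ?_
    (dualIsog_eq_zero_iff W'' h h') (T := zeroPoint W) ?_ ?_ ?_ fg_rat
  · ext P
    refine ⟨fun hP ↦ mem_range_dualIsog_of_isSquare W'' h h' hW (hsq P hP), ?_⟩
    rintro ⟨Q, rfl⟩
    exact freeCoord_eq_zero_of_sq (descentRep_dualIsog W'' h h' Q)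
  · ext P
    refine ⟨fun hP ↦ mem_range_isog_of_isSquare h hW' (hsq' P hP), ?_⟩
    rintro ⟨Q, rfl⟩
    exact freeCoord_eq_zero_of_sq (descentRep_isog h Q)
  · intro h0
    have := hsq' _ h0
    rw [zeroPoint, descentRep_some_of_eq_zero _ rfl] at this
    exact hW' this
  · intro P
    refine ⟨fun hP ↦ ?_, ?_⟩
    · rcases eq_zero_or_of_isOfFinAddOrder haW hmod hposW hP with hP | ⟨_, hP⟩
      · exact Or.inl hP
      · exact Or.inr hP
    · rintro (rfl | rfl)
      · exact IsOfFinAddOrder.zero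
      · rw [isOfFinAddOrder_iff_nsmul_eq_zero]
        exact ⟨2, two_pos, by
          rw [two_nsmul, zeroPoint, Affine.Point.add_self_of_Y_eq (by rw [negY, neg_zero])]⟩
  · intro h0
    have := hsq _ h0
    rw [zeroPoint, descentRep_some_of_eq_zero _ rfl] at this
    exact hW this

/-- The upper bound on the image: each coordinate in Z is a chosen valuation or vanishes
identically, and the local equations determine the rest. -/
lemma isSquare_of_freeCoord_eq_zero (haW : W.a₄ = a) (ha : IsSimpleOutsideSix a)
    {k : Fin 8 → Fin 19} {Z : Finset (Fin 20)} {L : Fin 20 → ℕ} (hL : IsEliminated a Z L)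
    (hZ : ∀ i ∈ Z, (∃ j, (k j).succ = i) ∨ ∀ P, descentCoord W i P = 0) {P : W.toAffine.Point}
    (hP : freeCoord W k P = 0) : IsSquare (descentRep P) := by
  refine isSquare_descentRep haW ha (descentCoord_eq_zero haW ha hL fun i hi ↦ ?_)
  rcases hZ i hi with ⟨j, rfl⟩ | h
  · exact congrFun hP j
  · exact h P

end WeierstrassCurve.IsX3AddX

/-! ### Numerical data and the rank over ℚ. -/

section Watkins

open WeierstrassCurve IsX3AddX

instance : watkinsCurve.IsX3AddX := ⟨rfl, rfl, rfl, rfl⟩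

/-- The coefficient of the curve of Watkins. -/
abbrev watkinsCoeff : ℤ := 402599774387690701016910427272483

lemma watkinsCurve_a₄ : watkinsCurve.a₄ = watkinsCoeff := by
  norm_num [watkinsCurve]

lemma isElliptic_curve {a : ℚ} (ha : a ≠ 0) : (curve a).IsElliptic where
  isUnit := by
    rw [isUnit_iff_ne_zero, Δ_eq]
    exact mul_ne_zero (by norm_num) (pow_ne_zero 3 ha)

theorem finrank_watkinsCurve :
    Module.Finite ℤ watkinsCurve.toAffine.Point ∧
      Module.finrank ℤ watkinsCurve.toAffine.Point = 14 := by
  have ha0 : watkinsCurve.a₄ ≠ 0 := a₄_ne_zero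
  have : (curve (-4 * watkinsCurve.a₄)).IsElliptic := isElliptic_curve (by simpa using ha0)
  have : (curve (-4 * (curve (-4 * watkinsCurve.a₄)).a₄)).IsElliptic :=
    isElliptic_curve (by simpa [curve] using ha0)
  have ha' : (curve (-4 * watkinsCurve.a₄)).a₄ = ((-4 * watkinsCoeff : ℤ) : ℚ) := by
    norm_num [curve, watkinsCurve_a₄]
  have key := finrank_point_add_two (W := watkinsCurve) (a := watkinsCoeff)
    (a' := -4 * watkinsCoeff) (W' := curve (-4 * watkinsCurve.a₄))
    (W'' := curve (-4 * (curve (-4 * watkinsCurve.a₄)).a₄)) rfl rfl watkinsCurve_a₄ ha'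
    (by norm_num) (by norm_num)
    -- The primes 71, 97, 139, 151, 263, 313, 443 and 733.
    (k := ![9, 11, 13, 14, 15, 16, 17, 18])
    -- Column j is a solution of w² = d₁X⁴ + d₂Z⁴ with d₁d₂ = a; of the eight chosen primes, d₁ is
    -- divisible only by the j-th, and just once.
    (d₁ := ![557137, 361131, 17982175491, 423953475561, 276628518243, 7406952538491, 1088175011,
      3636876801426033])
    (d₂ := ![722622576471659037215102259, 1114830281498100968947308393, 22388824677480771062113,
      949631970477296277803, 1455380583841443343681, 54354307293794453113,
      369977044425706538317953, 110699316025725651])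
    (X := ![423685, 12974, 1321, 1769, 4349, 1909, 3618, 113])
    (Z := ![3, 1, 1, 3, 13, 17, 1, 41])
    (w := ![276559791216598, 33389227506693, 277754516978, 2056369201818, 11854364660422,
      10144449857582, 745943429433, 951731566518])
    (k' := ![11, 12, 13, 14, 15, 16, 17, 18])
    (d₁' := ![23318867124, -28445068967, -7167674, -4084422018138, -883154, -135960314,
      -47643621354, -448298402])
    (d₂' := ![-69059919977558632108943, 56614350255892730037396, 224675270882961865183550718,
      394278331279026122014, 1823463515480610181313385558, 11844626201369046588607038,
      33800938127377654754158, 3592248132864776091857766])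
    (X' := ![6323, 12042, 38827, 9531, 100517, 84319, 5623, 2487])
    (Z' := ![2, 13, 1, 137, 1, 5, 19, 1])
    (w' := ![6014028705214, 31919027804682, 14435565526922, 324330549751034, 41633010228518,
      23030502440266, 66010169214202, 1890792925662])
    (by decide +kernel) (by decide +kernel)
    (fun P ↦ isSquare_of_freeCoord_eq_zero watkinsCurve_a₄ (by decide +kernel)
      -- The indices in k shifted by one, since coordinate 0 is the sign. In L, bit j selects the
      -- j-th local equation; the entries at indices in Z play no role.
      (Z := {10, 12, 14, 15, 16, 17, 18, 19})
      (L := ![1373, 633, 3976, 2751, 2399, 599, 2100, 2680, 1718, 578, 0, 757, 0, 3152, 0, 0, 0, 0,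
        0, 0]) (by decide +kernel) (fun i hi ↦ Or.inl (by revert i; decide)))
    (fun P ↦ isSquare_of_freeCoord_eq_zero ha' (by decide +kernel)
      -- Coordinate 2, the valuation at 3, is the extra one; it is removed by the separate argument
      -- at 3.
      (Z := {2, 12, 13, 14, 15, 16, 17, 18, 19})
      (L := ![3074, 2854, 0, 1106, 3166, 1547, 349, 1909, 840, 2853, 3612, 1058, 0, 0, 0, 0, 0, 0,
        0, 0]) (by decide +kernel) (fun i hi ↦ by
        by_cases h2 : i = 2
        · subst h2
          exact Or.inr (descentHom_valHom_three_eq_zero (c := -4 * watkinsCoeff / 9)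
            (ha'.trans (by norm_num)) (by rfl))
        · exact Or.inl (by revert i; decide)))
  exact ⟨key.1, by omega⟩

end Watkins

/-! ### Groups with an involution and an anticommuting square root of −1. -/

section QuadraticDescent

variable {A G : Type*} [AddCommGroup A] [AddCommGroup G] {j : A →+ G} {s ι : G →+ G}

/-- Both elements are fixed by s: applying s negates g − s g, and anticommutation with ι restores
the sign. -/
lemma add_mem_range_of_involution (hfix : ∀ g, s g = g → g ∈ j.range) (hss : ∀ g, s (s g) = g)
    (hι : ∀ g, s (ι g) = -ι (s g)) (g : G) :
    g + s g ∈ j.range ∧ ι (g - s g) ∈ j.range :=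
  ⟨hfix _ (by rw [map_add, hss, add_comm]),
    hfix _ (by rw [hι, map_sub, hss, ← map_neg, neg_sub])⟩

/-- The rank of the points over a quadratic extension of a group of points with complex
multiplication by `ι` with `ι² = -1` that anticommutes with conjugation. -/
theorem rank_eq_rank_add_rank {A G : Type} [AddCommGroup A] [AddCommGroup G] {j : A →+ G}
    {s ι : G →+ G} (hj : Function.Injective j) (hs : ∀ a, s (j a) = j a)
    (hfix : ∀ g, s g = g → g ∈ j.range) (hss : ∀ g, s (s g) = g)
    (hι : ∀ g, s (ι g) = -ι (s g)) (hιι : ∀ g, ι (ι g) = -g) :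
    Module.rank ℤ G = Module.rank ℤ A + Module.rank ℤ A := by
  let Θ : A × A →ₗ[ℤ] G := (j.coprod (ι.comp j)).toIntLinearMap
  have hΘ (p : A × A) : Θ p = j p.1 + ι (j p.2) := rfl
  have h2ι (g : G) : 2 • ι g = 0 → 2 • g = 0 := fun h ↦ by
    rw [← neg_eq_zero, ← smul_neg, ← hιι, ← map_nsmul, h, map_zero]
  -- Applying s to P + ιQ = 0 gives P − ιQ = 0, so the kernel is killed by 2.
  have hker : Module.rank ℤ (LinearMap.ker Θ) = 0 := by
    rw [Module.rank_eq_zero_iff_isTorsion]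
    rintro ⟨⟨P, Q⟩, hPQ⟩
    have h₁ : j P + ι (j Q) = 0 := hPQ
    have h₂ : j P - ι (j Q) = 0 := by
      have := congrArg s h₁
      rwa [map_add, hs, hι, hs, map_zero, ← sub_eq_add_neg] at this
    have hP : 2 • P = 0 := hj (by
      rw [map_zero, map_nsmul, two_nsmul]
      calc j P + j P = (j P + ι (j Q)) + (j P - ι (j Q)) := by abel
        _ = 0 := by rw [h₁, h₂, add_zero])
    have hQ : 2 • Q = 0 := hj (by
      rw [map_zero, map_nsmul]
      apply h2ι
      rw [two_nsmul]
      calc ι (j Q) + ι (j Q) = (j P + ι (j Q)) - (j P - ι (j Q)) := by abel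
        _ = 0 := by rw [h₁, h₂, sub_zero])
    refine ⟨⟨2, by simp⟩, Subtype.ext (Prod.ext ?_ ?_)⟩
    · exact (ofNat_zsmul P 2).trans hP
    · exact (ofNat_zsmul Q 2).trans hQ
  -- The cokernel is killed by 2: 2g = (g + s g) − ι(ι(g − s g)).
  have hquot : Module.rank ℤ (G ⧸ LinearMap.range Θ) = 0 := by
    rw [Module.rank_eq_zero_iff_isTorsion]
    intro q
    obtain ⟨g, rfl⟩ := Submodule.Quotient.mk_surjective _ q
    refine ⟨⟨2, by simp⟩, ?_⟩
    obtain ⟨⟨P, hP⟩, ⟨Q, hQ⟩⟩ := add_mem_range_of_involution hfix hss hι g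
    change (2 : ℤ) • (Submodule.Quotient.mk g : G ⧸ LinearMap.range Θ) = 0
    rw [← Submodule.Quotient.mk_smul, Submodule.Quotient.mk_eq_zero]
    refine ⟨(P, -Q), ?_⟩
    rw [hΘ, map_neg, map_neg, hQ, hιι, hP, neg_neg, two_zsmul]
    abel
  have hprod : Module.rank ℤ (A × A) = Module.rank ℤ A + Module.rank ℤ A := by
    rw [← LinearMap.rank_range_add_rank_ker (LinearMap.fst ℤ A A), LinearMap.ker_fst,
      LinearMap.range_eq_top.2 LinearMap.fst_surjective, rank_top,
      rank_range_of_injective _ LinearMap.inr_injective]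
  rw [← Submodule.rank_quotient_add_rank (LinearMap.range Θ), hquot, zero_add, ← hprod,
    ← LinearMap.rank_range_add_rank_ker Θ, hker, add_zero]

/-- For torsion g both summands of 2g = (g + s g) + (g − s g) lie in {0, t}. Hence so does 2g, and t
is not a double. -/
theorem eq_zero_or_eq_of_isOfFinAddOrder (hj : Function.Injective j)
    (hfix : ∀ g, s g = g → g ∈ j.range) (hss : ∀ g, s (s g) = g)
    (hι : ∀ g, s (ι g) = -ι (s g)) (hιι : ∀ g, ι (ι g) = -g) {t : G} (ht : 2 • t = 0)
    (htors : ∀ a : A, IsOfFinAddOrder a → j a = 0 ∨ j a = t) (hιt : ι t = t)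
    (h2 : ∀ g : G, 2 • g = 0 → g = 0 ∨ g = t) (h2t : ∀ g : G, 2 • g ≠ t) {g : G}
    (hg : IsOfFinAddOrder g) : g = 0 ∨ g = t := by
  have hrange (x : G) (hx : x ∈ j.range) (hx' : IsOfFinAddOrder x) : x = 0 ∨ x = t := by
    obtain ⟨a, rfl⟩ := hx
    exact htors a ((hj.isOfFinAddOrder_iff).1 hx')
  have hsg : IsOfFinAddOrder (s g) := s.isOfFinAddOrder hg
  obtain ⟨h₁, h₂⟩ := add_mem_range_of_involution hfix hss hι g
  have hadd := hrange _ h₁ (hg.add hsg)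
  have hsub : g - s g = 0 ∨ g - s g = t := by
    have e : g - s g = -ι (ι (g - s g)) := by rw [hιι, neg_neg]
    have hfin : IsOfFinAddOrder (ι (g - s g)) :=
      ι.isOfFinAddOrder (by rw [sub_eq_add_neg]; exact hg.add hsg.neg)
    rcases hrange _ h₂ hfin with h | h
    · left
      rw [e, h, map_zero, neg_zero]
    · right
      rw [e, h, hιt]
      exact neg_eq_of_add_eq_zero_left (by rw [← two_nsmul, ht])
  have h2g : 2 • g = (g + s g) + (g - s g) := by rw [two_nsmul]; abel
  rcases hadd with h | h <;> rcases hsub with h' | h' <;> rw [h, h'] at h2g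
  · exact h2 g (by rw [h2g, add_zero])
  · exact absurd (by rw [h2g, zero_add]) (h2t g)
  · exact absurd (by rw [h2g, add_zero]) (h2t g)
  · exact h2 g (by rw [h2g, ← two_nsmul, ht])

lemma nonempty_torsion_addEquiv_zmod_two {t : G} (ht0 : t ≠ 0)
    (ht : ∀ g : G, IsOfFinAddOrder g ↔ g = 0 ∨ g = t) :
    Nonempty (AddCommGroup.torsion G ≃+ ZMod 2) := by
  have hcard : Nat.card (AddCommGroup.torsion G) = 2 := by
    rw [Nat.card_eq_two_iff]
    refine ⟨0, ⟨t, (ht t).2 (Or.inr rfl)⟩, fun h ↦ ht0 (congrArg Subtype.val h).symm, ?_⟩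
    ext ⟨g, hg⟩
    simpa [Subtype.ext_iff] using (ht g).1 hg
  have := isAddCyclic_of_prime_card hcard
  exact ⟨(zmodAddCyclicAddEquiv this).symm.trans (ZMod.ringEquivCongr hcard).toAddEquiv⟩

end QuadraticDescent

/-! ### Points of order two, and points over ℚ(i). -/

namespace WeierstrassCurve.IsX3AddX

section TwoTorsion

variable {F : Type*} [Field F] [DecidableEq F] {W : WeierstrassCurve F} [W.IsX3AddX] [W.IsElliptic]

lemma two_nsmul_zeroPoint : 2 • zeroPoint W = 0 := by
  rw [two_nsmul, zeroPoint, Affine.Point.add_self_of_Y_eq (by rw [negY, neg_zero])]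

/-- The class of 2P is a square, while that of (0, 0) is a. -/
lemma two_nsmul_ne_zeroPoint (ha : ¬ IsSquare W.a₄) (P : W.toAffine.Point) :
    2 • P ≠ zeroPoint W := by
  intro h
  obtain ⟨u, hu⟩ := exists_descentRep_add P P
  rw [← two_nsmul, h, zeroPoint, descentRep_some_of_eq_zero _ rfl] at hu
  have h0 := descentRep_ne_zero P
  exact ha ⟨u / descentRep P, by field_simp; linear_combination hu⟩

lemma eq_zero_or_eq_zeroPoint (ha : ¬ IsSquare (-W.a₄)) {P : W.toAffine.Point} (hP : 2 • P = 0) :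
    P = 0 ∨ P = zeroPoint W := by
  rcases P with _ | ⟨x, y, h⟩
  · exact Or.inl rfl
  right
  have e := (nonsingular_iff W).1 h
  rw [two_nsmul, add_eq_zero_iff_eq_neg, Affine.Point.neg_some, Affine.Point.some.injEq, negY] at hP
  have hy : y = 0 := by
    have : 2 * y = 0 := by linear_combination hP.2
    exact (mul_eq_zero.1 this).resolve_left (two_ne_zero (W := W))
  subst hy
  have : x * (x ^ 2 + W.a₄) = 0 := by linear_combination -e
  rcases mul_eq_zero.1 this with rfl | h'
  · rfl
  · exact absurd ⟨x, by linear_combination -h'⟩ ha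

end TwoTorsion

section Gaussian

variable {K : Type*} [Field K] [DecidableEq K] [Algebra ℚ K] {i : K} {σ : K →ₐ[ℚ] K}
  {W : WeierstrassCurve ℚ} [W.IsX3AddX] [W.IsElliptic]

omit [DecidableEq K] in
-- If z² = a then σz = ±z, so z or iz is rational, and a or −a is a square in ℚ.
lemma not_isSquare_algebraMap (hi : i ^ 2 = -1) (hσi : σ i = -i)
    (hσ : ∀ z, σ z = z → z ∈ (algebraMap ℚ K).range) {a : ℚ} (ha : ¬ IsSquare a)
    (ha' : ¬ IsSquare (-a)) : ¬ IsSquare (algebraMap ℚ K a) := by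
  have hinj := (algebraMap ℚ K).injective
  rintro ⟨z, hz⟩
  have hσz : σ z * σ z = z * z := by rw [← map_mul, ← hz, AlgHom.commutes]
  rcases mul_self_eq_mul_self_iff.1 hσz with h | h
  · obtain ⟨r, rfl⟩ := hσ z h
    exact ha ⟨r, hinj (by rw [hz, map_mul])⟩
  · obtain ⟨r, hr⟩ := hσ (i * z) (by rw [map_mul, h, hσi, neg_mul_neg])
    exact ha' ⟨r, hinj (by
      rw [map_mul, hr, map_neg, hz]
      linear_combination (-z ^ 2) * hi)⟩

/-- The action of a field homomorphism on points. -/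
noncomputable def conj (W : WeierstrassCurve ℚ) (σ : K →ₐ[ℚ] K) :
    (W.baseChange K).toAffine.Point →+ (W.baseChange K).toAffine.Point :=
  Affine.Point.map (W' := W) σ

omit [W.IsX3AddX] [W.IsElliptic] in
lemma conj_some {x y : K} (h : (W.baseChange K).toAffine.Nonsingular x y) :
    ∃ h', conj W σ (.some x y h) =
      .some (W' := (W.baseChange K).toAffine) (σ x) (σ y) h' := ⟨_, rfl⟩

omit [W.IsX3AddX] [W.IsElliptic] in
lemma conj_toExt (P : W.toAffine.Point) : conj W σ (toExt W K P) = toExt W K P := by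
  rcases P with _ | ⟨x, y, h⟩
  · rfl
  · obtain ⟨h₁, e⟩ := toExt_some K h
    obtain ⟨_, e'⟩ := conj_some (σ := σ) h₁
    rw [e, e']
    simp

omit [W.IsX3AddX] [W.IsElliptic] in
lemma conj_conj (hσσ : ∀ z, σ (σ z) = z) (P : (W.baseChange K).toAffine.Point) :
    conj W σ (conj W σ P) = P := by
  rcases P with _ | ⟨x, y, h⟩
  · rfl
  · obtain ⟨h₁, e⟩ := conj_some (σ := σ) h
    obtain ⟨_, e'⟩ := conj_some (σ := σ) h₁
    rw [e, e']
    simp [hσσ]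

lemma mem_range_toExt (hσ : ∀ z, σ z = z → z ∈ (algebraMap ℚ K).range)
    (P : (W.baseChange K).toAffine.Point) (hP : conj W σ P = P) : P ∈ (toExt W K).range := by
  rcases P with _ | ⟨x, y, h⟩
  · exact zero_mem _
  · obtain ⟨_, e⟩ := conj_some (σ := σ) h
    rw [e, Affine.Point.some.injEq] at hP
    obtain ⟨x, rfl⟩ := hσ x hP.1
    obtain ⟨y, rfl⟩ := hσ y hP.2
    have h' := (nonsingular_iff _).1 h
    have hxy : W.toAffine.Nonsingular x y := by
      rw [nonsingular_iff]
      apply (algebraMap ℚ K).injective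
      rw [map_add, map_mul, map_pow, map_pow]
      exact h'
    exact ⟨.some x y hxy, (toExt_some K hxy).2⟩

/-- The automorphism `(x, y) ↦ (-x, -i y)` of `y² = x³ + a x` for `i² = -1`. -/
noncomputable def mulI (W : WeierstrassCurve ℚ) [W.IsX3AddX] [W.IsElliptic] (hi : i ^ 2 = -1) :
    (W.baseChange K).toAffine.Point →+ (W.baseChange K).toAffine.Point :=
  scale i (by rintro rfl; simp at hi) (by
    linear_combination (1 - i ^ 2) * (W.baseChange K).a₄ * hi)

lemma mulI_some (hi : i ^ 2 = -1) {x y : K} (h : (W.baseChange K).toAffine.Nonsingular x y) :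
    ∃ h', mulI W hi (.some x y h) =
      .some (W' := (W.baseChange K).toAffine) (-x) (-i * y) h' := by
  have e₁ : i ^ 2 * x = -x := by rw [hi]; ring
  have e₂ : i ^ 3 * y = -i * y := by linear_combination i * y * hi
  rw [mulI, scale_some]
  simp only [e₁, e₂, exists_prop, and_true]
  rw [nonsingular_iff] at h ⊢
  linear_combination y ^ 2 * hi - h

lemma mulI_mulI (hi : i ^ 2 = -1) (P : (W.baseChange K).toAffine.Point) :
    mulI W hi (mulI W hi P) = -P := by
  rcases P with _ | ⟨x, y, h⟩
  · rfl
  · obtain ⟨h₁, e⟩ := mulI_some hi h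
    obtain ⟨_, e'⟩ := mulI_some hi h₁
    rw [e, e', Affine.Point.neg_some, Affine.Point.some.injEq, negY]
    exact ⟨neg_neg x, by linear_combination y * hi⟩

lemma mulI_zeroPoint (hi : i ^ 2 = -1) :
    mulI W hi (zeroPoint (W.baseChange K)) = zeroPoint (W.baseChange K) := by
  obtain ⟨_, e⟩ := mulI_some (W := W) hi (x := 0) (y := 0) ((nonsingular_iff _).2 (by simp))
  refine e.trans ?_
  simp [zeroPoint]

lemma conj_mulI (hi : i ^ 2 = -1) (hσi : σ i = -i) (P : (W.baseChange K).toAffine.Point) :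
    conj W σ (mulI W hi P) = -mulI W hi (conj W σ P) := by
  rcases P with _ | ⟨x, y, h⟩
  · rfl
  · obtain ⟨h₁, e⟩ := mulI_some hi h
    obtain ⟨_, e'⟩ := conj_some (σ := σ) h₁
    obtain ⟨h₂, f⟩ := conj_some (σ := σ) h
    obtain ⟨_, f'⟩ := mulI_some hi h₂
    rw [e, e', f, f', Affine.Point.neg_some, Affine.Point.some.injEq, negY]
    simp [hσi]

/-- The rank of `y² = x³ + a x` over `ℚ(i)` is twice the rank over `ℚ`. -/
theorem rank_baseChange {K : Type} [Field K] [DecidableEq K] [Algebra ℚ K] {i : K}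
    {σ : K →ₐ[ℚ] K} (hi : i ^ 2 = -1) (hσi : σ i = -i)
    (hσσ : ∀ z, σ (σ z) = z) (hσ : ∀ z, σ z = z → z ∈ (algebraMap ℚ K).range) :
    Module.rank ℤ (W.baseChange K).toAffine.Point =
      Module.rank ℤ W.toAffine.Point + Module.rank ℤ W.toAffine.Point := by
  exact rank_eq_rank_add_rank (toExt_injective (W := W) K) (conj_toExt (σ := σ))
    (mem_range_toExt hσ) (conj_conj hσσ) (conj_mulI hi hσi) (mulI_mulI hi)

theorem torsion_baseChange (hi : i ^ 2 = -1) (hσi : σ i = -i)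
    (hσσ : ∀ z, σ (σ z) = z) (hσ : ∀ z, σ z = z → z ∈ (algebraMap ℚ K).range)
    (hW : ¬ IsSquare W.a₄) (hW' : ¬ IsSquare (-W.a₄))
    (htors : ∀ P : W.toAffine.Point, IsOfFinAddOrder P → P = 0 ∨ P = zeroPoint W) :
    Nonempty (AddCommGroup.torsion (W.baseChange K).toAffine.Point ≃+ ZMod 2) := by
  have ha : (W.baseChange K).a₄ = algebraMap ℚ K W.a₄ := rfl
  have h0 : zeroPoint (W.baseChange K) ≠ 0 := Affine.Point.some_ne_zero _
  refine nonempty_torsion_addEquiv_zmod_two h0 fun g ↦ ⟨fun hg ↦ ?_, ?_⟩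
  · refine eq_zero_or_eq_of_isOfFinAddOrder (toExt_injective (W := W) K)
      (mem_range_toExt hσ) (conj_conj hσσ) (conj_mulI hi hσi) (mulI_mulI hi) two_nsmul_zeroPoint
      (fun P hP ↦ ?_) (mulI_zeroPoint hi) (fun P hP ↦ eq_zero_or_eq_zeroPoint ?_ hP)
      (two_nsmul_ne_zeroPoint ?_) hg
    · rcases htors P hP with rfl | rfl
      · exact Or.inl (map_zero _)
      · right
        obtain ⟨_, e⟩ := toExt_some (W := W) K (x := 0) (y := 0) ((nonsingular_iff W).2 (by simp))
        refine e.trans ?_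
        simp [zeroPoint]
    · rw [ha, ← map_neg]
      exact not_isSquare_algebraMap hi hσi hσ hW' (by rwa [neg_neg])
    · rw [ha]
      exact not_isSquare_algebraMap hi hσi hσ hW hW'
  · rintro (rfl | rfl)
    · exact IsOfFinAddOrder.zero
    · exact isOfFinAddOrder_iff_nsmul_eq_zero.2 ⟨2, two_pos, two_nsmul_zeroPoint⟩

end Gaussian

end WeierstrassCurve.IsX3AddX

/-! ### The field ℚ(i) and its conjugation. -/

section GaussianField

lemma isIntegral_I : IsIntegral ℚ Complex.I :=
  ⟨Polynomial.X ^ 2 + 1, by monicity!, by simp⟩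

/-- The imaginary unit as an element of `ℚ(i)`. -/
noncomputable def gaussianI : ℚ⟮Complex.I⟯ :=
  ⟨Complex.I, IntermediateField.mem_adjoin_simple_self ℚ _⟩

lemma gaussianI_sq : gaussianI ^ 2 = -1 := Subtype.ext Complex.I_sq

lemma exists_eq_add_mul_I {z : ℂ} (hz : z ∈ ℚ⟮Complex.I⟯) :
    ∃ p q : ℚ, z = p + q * Complex.I := by
  rw [← IntermediateField.mem_toSubalgebra,
    IntermediateField.adjoin_simple_toSubalgebra_of_isAlgebraic isIntegral_I.isAlgebraic] at hz
  induction hz using Algebra.adjoin_induction with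
  | mem x hx => exact ⟨0, 1, by rw [Set.mem_singleton_iff.1 hx]; simp⟩
  | algebraMap r => exact ⟨r, 0, by simp⟩
  | add x y _ _ hx hy =>
    obtain ⟨p, q, rfl⟩ := hx
    obtain ⟨r, s, rfl⟩ := hy
    exact ⟨p + r, q + s, by push_cast; ring⟩
  | mul x y _ _ hx hy =>
    obtain ⟨p, q, rfl⟩ := hx
    obtain ⟨r, s, rfl⟩ := hy
    exact ⟨p * r - q * s, p * s + q * r, by
      push_cast; linear_combination (q * s : ℂ) * Complex.I_sq⟩

lemma star_mem_adjoin_I {z : ℂ} (hz : z ∈ ℚ⟮Complex.I⟯) :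
    (Complex.conjAe.restrictScalars ℚ) z ∈ ℚ⟮Complex.I⟯ := by
  obtain ⟨p, q, rfl⟩ := exists_eq_add_mul_I hz
  have hI := IntermediateField.mem_adjoin_simple_self ℚ Complex.I
  have h (r : ℚ) : (r : ℂ) ∈ ℚ⟮Complex.I⟯ := by
    simp
  have e : (Complex.conjAe.restrictScalars ℚ) (p + q * Complex.I) = p + q * -Complex.I := by simp
  rw [e]
  exact add_mem (h p) (mul_mem (h q) (neg_mem hI))

/-- Complex conjugation on `ℚ(i)`. -/
noncomputable def gaussianConj : ℚ⟮Complex.I⟯ →ₐ[ℚ] ℚ⟮Complex.I⟯ :=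
  (((Complex.conjAe.restrictScalars ℚ).toAlgHom.comp (ℚ⟮Complex.I⟯).val).codRestrict
    (ℚ⟮Complex.I⟯).toSubalgebra fun z ↦ star_mem_adjoin_I z.2)

lemma gaussianConj_gaussianI : gaussianConj gaussianI = -gaussianI :=
  Subtype.ext Complex.conj_I

lemma gaussianConj_gaussianConj (z : ℚ⟮Complex.I⟯) : gaussianConj (gaussianConj z) = z :=
  Subtype.ext (Complex.conj_conj _)

lemma mem_range_of_gaussianConj_eq (z : ℚ⟮Complex.I⟯) (hz : gaussianConj z = z) :
    z ∈ (algebraMap ℚ ℚ⟮Complex.I⟯).range := by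
  obtain ⟨p, q, h⟩ := exists_eq_add_mul_I z.2
  have him := Complex.conj_eq_iff_im.1 (congrArg Subtype.val hz)
  have hq : (q : ℝ) = 0 := by
    change (z : ℂ).im = 0 at him
    rw [h] at him
    simpa using him
  refine ⟨p, Subtype.ext ?_⟩
  rw [h]
  norm_cast at hq
  simp [hq]

lemma finrank_gaussian : Module.finrank ℚ ℚ⟮Complex.I⟯ = 2 := by
  have hm : Polynomial.Monic (Polynomial.X ^ 2 + 1 : Polynomial ℚ) := by monicity!
  have hd : (Polynomial.X ^ 2 + 1 : Polynomial ℚ).natDegree = 2 := by compute_degree!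
  have hirr : Irreducible (Polynomial.X ^ 2 + 1 : Polynomial ℚ) := by
    rw [Polynomial.irreducible_iff_roots_eq_zero_of_degree_le_three (by rw [hd])
      (by rw [hd]; norm_num)]
    refine Multiset.eq_zero_of_forall_notMem fun r hr ↦ ?_
    have := (Polynomial.mem_roots'.1 hr).2
    simp only [Polynomial.IsRoot, Polynomial.eval_add, Polynomial.eval_pow, Polynomial.eval_X,
      Polynomial.eval_one] at this
    nlinarith
  rw [IntermediateField.adjoin.finrank isIntegral_I,
    ← minpoly.eq_of_irreducible_of_monic hirr (by simp) hm, hd]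

instance : NumberField ℚ⟮Complex.I⟯ where
  to_finiteDimensional := IntermediateField.adjoin.finiteDimensional isIntegral_I

end GaussianField

/-! ### Conclusions for Watkins' curve. -/

section Watkins

open WeierstrassCurve IsX3AddX

lemma not_isSquare_watkinsCurve_a₄ : ¬ IsSquare watkinsCurve.a₄ := by
  rw [watkinsCurve_a₄]
  exact not_isSquare_of_emod_four (by norm_num)

lemma curveRank_watkinsCurve : curveRank watkinsCurve = 14 := by
  obtain ⟨_, h⟩ := finrank_watkinsCurve
  rw [curveRank, abRank, ← Module.finrank_eq_rank, h]
  rfl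

/-- Decidable equality is left arbitrary so that the result also serves the classical choice in
`rankBound`. -/
lemma curveRank_watkinsCurve_gaussian {_ : DecidableEq ℚ⟮Complex.I⟯} :
    curveRank (watkinsCurve.baseChange ℚ⟮Complex.I⟯) = 28 := by
  rw [curveRank, abRank, rank_baseChange gaussianI_sq gaussianConj_gaussianI
    gaussianConj_gaussianConj mem_range_of_gaussianConj_eq]
  change curveRank watkinsCurve + curveRank watkinsCurve = 28
  rw [curveRank_watkinsCurve]
  norm_num

lemma hasTorsion_watkinsCurve_gaussian {_ : DecidableEq ℚ⟮Complex.I⟯} :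
    HasTorsion (watkinsCurve.baseChange ℚ⟮Complex.I⟯) (ZMod 2) := by
  have hpos : 0 < watkinsCurve.a₄ := by norm_num [watkinsCurve]
  refine torsion_baseChange gaussianI_sq gaussianConj_gaussianI gaussianConj_gaussianConj
    mem_range_of_gaussianConj_eq not_isSquare_watkinsCurve_a₄ (fun h ↦ ?_) fun P hP ↦ ?_
  · have := h.nonneg
    linarith
  · rcases eq_zero_or_of_isOfFinAddOrder watkinsCurve_a₄ (by norm_num) hpos hP with h | ⟨_, h⟩
    · exact Or.inl h
    · exact Or.inr h

/-- Only a₄ is nonzero, and twisting by d multiplies it by d² = 1; the twist is the curve itself. -/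
lemma quadraticTwist_watkinsCurve : quadraticTwist watkinsCurve (-1) = watkinsCurve := by
  ext <;> simp [quadraticTwist, watkinsCurve, b₂, b₄, b₆]

lemma le_rankBound : 28 ≤ rankBound (ZMod 2) := by
  classical
  refine le_sSup ⟨ℚ⟮Complex.I⟯, inferInstance, inferInstance,
    watkinsCurve.baseChange ℚ⟮Complex.I⟯, ?_, inferInstance, hasTorsion_watkinsCurve_gaussian, ?_⟩
  · convert finrank_gaussian
  · rw [curveRank_watkinsCurve_gaussian]
    simp

end Watkins

theorem mainTheorem5 :
    watkinsCurve.j = 1728 ∧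
    curveRank watkinsCurve = 14 ∧
    IsIsomorphic watkinsCurve (quadraticTwist watkinsCurve (-1)) ∧
    curveRank (quadraticTwist watkinsCurve (-1)) = 14 ∧
    curveRank (watkinsCurve.baseChange ℚ⟮Complex.I⟯) = 28 ∧
    HasTorsion (watkinsCurve.baseChange ℚ⟮Complex.I⟯) (ZMod 2) ∧
    28 ≤ rankBound (ZMod 2) := by
  refine ⟨?_, curveRank_watkinsCurve, ⟨1, ?_⟩, ?_, curveRank_watkinsCurve_gaussian,
    hasTorsion_watkinsCurve_gaussian, le_rankBound⟩
  · have h := watkinsCurve_isElliptic.isUnit.ne_zero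
    rw [WeierstrassCurve.j, Units.val_inv_eq_inv_val, WeierstrassCurve.coe_Δ',
      inv_mul_eq_iff_eq_mul₀ h]
    norm_num [watkinsCurve, WeierstrassCurve.Δ, WeierstrassCurve.c₄, WeierstrassCurve.b₂,
      WeierstrassCurve.b₄, WeierstrassCurve.b₆, WeierstrassCurve.b₈]
  · rw [quadraticTwist_watkinsCurve, one_smul]
  · rw [quadraticTwist_watkinsCurve, curveRank_watkinsCurve]
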